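/- Let $d\ge 1$ and $q\ge 1$ be integers, let $z=(z_1,\dots,z_q)$ with all $z_j>0$, and let $Q=(Q_1,\dots,Q_q)$ be probability measures on $\mathbb{R}^+=[0,\infty)$. Let $\Omega$ be the set of locally finite configurations $\omega\subset\mathbb{R}^d\times\mathbb{R}^+$ (that is, $\omega\cap(\Lambda\times\mathbb{R}^+)$ is finite for every bounded $\Lambda\subset\mathbb{R}^d$), with the $\sigma$-algebra generated by the counting variables $\omega\mapsto|\omega\cap B|$, $B$ Borel, and give $\Omega^q$ the product $\sigma$-algebra. Write $\omega_\Lambda=\omega\cap(\Lambda\times\mathbb{R}^+)$ and $L(\omega)=\bigcup_{(x,r)\in\omega}\bar B(x,r)$ (closed Euclidean balls); for $\boldsymbol\omega\in\Omega^q$ restriction and union are taken colour by colour. For $y\in[0,\infty)^q$ let $\pi^{y,Q}=\pi^{y_1,Q_1}\otimes\dots\otimes\pi^{y_q,Q_q}$, where $\pi^{y_j,Q_j}$ is the law on $\Omega$ of the Poisson point process with intensity measure $y_j\,\mathcal{L}^d\otimes Q_j$ ($\mathcal{L}^d$ is Lebesgue measure), and let $\pi^{y,Q}_\Lambda$ be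 the law of $\boldsymbol\omega_\Lambda$ under $\pi^{y,Q}$. Let $\mathcal{A}=\{\boldsymbol\omega\in\Omega^q: L(\omega^j)\cap L(\omega^k)=\emptyset \text{ for all } j<k\}$ and $$Z_\Lambda(\boldsymbol\omega_{\Lambda^c})=\int \mathbf{1}_{\mathcal{A}}(\boldsymbol\omega'_\Lambda\cup\boldsymbol\omega_{\Lambda^c})\,\pi^{z,Q}_\Lambda(d\boldsymbol\omega'_\Lambda).$$ Let $WR(z,Q)$ be the set of probability measures $P$ on $\Omega^q$ which are stationary (invariant under all translations of $\mathbb{R}^d$) and such that, for every bounded Borel set $\Lambda\subset\mathbb{R}^d$, one has $Z_\Lambda(\boldsymbol\omega_{\Lambda^c})>0$ for $P$-almost every $\boldsymbol\omega$, and, for every bounded measurable $f:\Omega^q\to\mathbb{R}$, $$\int f\,dP=\int\!\!\int f(\boldsymbol\omega'_\Lambda\cup\boldsymbol\omega_{\Lambda^c})\,\frac{\mathbf{1}_{\mathcal{A}}(\boldsymbol\omega'_\Lambda\cup\boldsymbol\omega_{\Lambda^c})}{Z_\Lambda(\boldsymbol\omega_{\Lambda^c})}\,\pi^{z,Q}_\Lambda(d\boldsymbol\omega'_\Lambda)\,P(d\boldsymbol\omega).$$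 Then for every colour $i\in\{1,\dots,q\}$ with $\int_{\mathbb{R}^+} r^d\,Q_i(dr)=\infty$, the single-colour Poisson law $\pi^{\bar z^i,Q}$ with activity vector $\bar z^i=(0,\dots,0,z_i,0,\dots,0)$ belongs to $WR(z,Q)$ and is an extreme point of $WR(z,Q)$: if $\pi^{\bar z^i,Q}=aP_1+bP_2$ with $P_1,P_2\in WR(z,Q)$, $a,b>0$ and $a+b=1$, then $P_1=P_2=\pi^{\bar z^i,Q}$. -/

import Mathlib

open MeasureTheory ProbabilityTheory Set
open scoped NNReal ENNReal

noncomputable section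

namespace WidomRowlinson

/-- The state space `S = ℝ^d × ℝ₊` of marked points (centre, radius). -/
abbrev State (d : ℕ) : Type := EuclideanSpace ℝ (Fin d) × ℝ≥0

/-- The locally finite configurations on `S`: sets of marked points having finitely many points
with centre in any given bounded subset of `ℝ^d`. -/
@[ext]
structure Config (d : ℕ) where
  carrier : Set (State d)
  locallyFinite : ∀ Λ : Set (EuclideanSpace ℝ (Fin d)), Bornology.IsBounded Λ →
    (carrier ∩ Λ ×ˢ univ).Finite

namespace Config

variable {d : ℕ}

/-- The counting variable `N_B(ω) = |ω ∩ B|`. -/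
def count (B : Set (State d)) (ω : Config d) : ℕ∞ := (ω.carrier ∩ B).encard

/-- The `σ`-algebra on configurations generated by the counting variables of Borel sets. -/
instance instMeasurableSpace : MeasurableSpace (Config d) :=
  ⨆ (B : Set (State d)) (_ : MeasurableSet B),
    MeasurableSpace.comap (count B) (inferInstance : MeasurableSpace ℕ∞)

/-- The restriction `ω_Λ = ω ∩ (Λ × ℝ₊)`. -/
def restrict (Λ : Set (EuclideanSpace ℝ (Fin d))) (ω : Config d) : Config d where
  carrier := ω.carrier ∩ Λ ×ˢ univ
  locallyFinite Δ hΔ := (ω.locallyFinite Δ hΔ).subset fun _ hX => ⟨hX.1.1, hX.2⟩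

/-- The union of two configurations. -/
instance instUnion : Union (Config d) where
  union ω ω' :=
    { carrier := ω.carrier ∪ ω'.carrier
      locallyFinite := fun Δ hΔ => by
        rw [union_inter_distrib_right]
        exact (ω.locallyFinite Δ hΔ).union (ω'.locallyFinite Δ hΔ) }

/-- The translate of a configuration by `x`: centres are shifted by `x`, radii are kept. -/
def translate (x : EuclideanSpace ℝ (Fin d)) (ω : Config d) : Config d where
  carrier := (fun X : State d => (X.1 + x, X.2)) '' ω.carrier
  locallyFinite Δ hΔ := by
    have hb : Bornology.IsBounded ((fun y => y + (-x)) '' Δ) := by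
      rw [← add_singleton]
      exact hΔ.add Bornology.isBounded_singleton
    refine ((ω.locallyFinite _ hb).image fun X : State d => (X.1 + x, X.2)).subset ?_
    rintro _ ⟨⟨X, hX, rfl⟩, hΔX⟩
    refine ⟨X, ⟨hX, ⟨X.1 + x, hΔX.1, ?_⟩, trivial⟩, rfl⟩
    simp

/-- The germ-grain structure `L(ω)`: the union of the closed balls of the configuration. -/
def grains (ω : Config d) : Set (EuclideanSpace ℝ (Fin d)) :=
  ⋃ X ∈ ω.carrier, Metric.closedBall X.1 (X.2 : ℝ)

end Config

/-- `P` is the law of a Poisson point process on `S` with intensity measure `ν`: the number of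
points in a Borel set of finite intensity `ν B` has the Poisson distribution of parameter `ν B`,
and the numbers of points in pairwise disjoint such sets are independent. -/
structure IsPoissonProcess {d : ℕ} (ν : Measure (State d)) (P : Measure (Config d)) : Prop where
  isProbabilityMeasure : IsProbabilityMeasure P
  map_count : ∀ B : Set (State d), MeasurableSet B → ν B ≠ ∞ →
    P.map (Config.count B) = (poissonMeasure (ν B).toNNReal).map (fun n : ℕ => (n : ℕ∞))
  iIndepFun_count : ∀ (n : ℕ) (B : Fin n → Set (State d)),
    (∀ k, MeasurableSet (B k)) → (∀ k, ν (B k) ≠ ∞) → Pairwise (fun k l => Disjoint (B k) (B l)) →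
    iIndepFun (fun k => Config.count (B k)) P

open Classical in
/-- The law `π^{z,Q}` of the Poisson point process with intensity measure `z 𝓛^d ⊗ Q`. This law is
characterised uniquely by `IsPoissonProcess`; the value `0`, which is not a probability measure,
would be taken only if there were no such law. -/
def poissonLaw {d : ℕ} (z : ℝ≥0) (Q : Measure ℝ≥0) : Measure (Config d) :=
  if h : ∃ P : Measure (Config d),
      IsPoissonProcess (z • (volume : Measure (EuclideanSpace ℝ (Fin d))).prod Q) P
  then h.choose else 0

/-- Configurations of particles of `q` colours, with the product `σ`-algebra. -/
abbrev MultiConfig (d q : ℕ) : Type := Fin q → Config d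

/-- The law of the multi-colour Poisson point process: independent colours, colour `j` having
activity `z j` and radius distribution `Q j`. -/
def multiPoisson {d q : ℕ} (z : Fin q → ℝ≥0) (Q : Fin q → Measure ℝ≥0) :
    Measure (MultiConfig d q) :=
  Measure.pi fun j => poissonLaw (z j) (Q j)

/-- The colourwise restriction `ω_Λ`. -/
def multiRestrict {d q : ℕ} (Λ : Set (EuclideanSpace ℝ (Fin d))) (ω : MultiConfig d q) :
    MultiConfig d q :=
  fun j => (ω j).restrict Λ

/-- The configuration `ω'_Λ ∪ ω_{Λᶜ}`. -/
def glue {d q : ℕ} (Λ : Set (EuclideanSpace ℝ (Fin d))) (ω' ω : MultiConfig d q) :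
    MultiConfig d q :=
  fun j => (ω' j).restrict Λ ∪ (ω j).restrict Λᶜ

/-- The restriction `π^{z,Q}_Λ` of the multi-colour Poisson law to `Λ`: the law of `ω_Λ`. -/
def multiPoissonOn {d q : ℕ} (z : Fin q → ℝ≥0) (Q : Fin q → Measure ℝ≥0)
    (Λ : Set (EuclideanSpace ℝ (Fin d))) : Measure (MultiConfig d q) :=
  (multiPoisson z Q).map (multiRestrict Λ)

/-- The event of authorized configurations: balls of different colours do not meet. -/
def authorized (d q : ℕ) : Set (MultiConfig d q) :=
  {ω | ∀ i j : Fin q, i < j → (ω i).grains ∩ (ω j).grains = ∅}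

/-- The partition function of the domain `Λ` with boundary condition `ω_{Λᶜ}`. -/
def partitionFunction {d q : ℕ} (z : Fin q → ℝ≥0) (Q : Fin q → Measure ℝ≥0)
    (Λ : Set (EuclideanSpace ℝ (Fin d))) (ω : MultiConfig d q) : ℝ≥0∞ :=
  multiPoissonOn z Q Λ {ω' | glue Λ ω' ω ∈ authorized d q}

/-- The Widom-Rowlinson specification on `Λ` with boundary condition `ω_{Λᶜ}`: the law of the
multi-colour Poisson process on `Λ` conditioned on `ω'_Λ ∪ ω_{Λᶜ}` being authorized. -/
def specification {d q : ℕ} (z : Fin q → ℝ≥0) (Q : Fin q → Measure ℝ≥0)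
    (Λ : Set (EuclideanSpace ℝ (Fin d))) (ω : MultiConfig d q) : Measure (MultiConfig d q) :=
  (partitionFunction z Q Λ ω)⁻¹ •
    (multiPoissonOn z Q Λ).restrict {ω' | glue Λ ω' ω ∈ authorized d q}

/-- A measure on multi-colour configurations is stationary if it is invariant under all
translations of `ℝ^d`. -/
def IsStationary {d q : ℕ} (P : Measure (MultiConfig d q)) : Prop :=
  ∀ x : EuclideanSpace ℝ (Fin d),
    P.map (fun (ω : MultiConfig d q) (j : Fin q) => (ω j).translate x) = P

/-- The set `WR(z, Q)` of Widom-Rowlinson measures: the stationary probability measures such that,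
for every bounded Borel set `Λ`, the partition function is almost surely positive and the DLR
equation holds for every bounded measurable function. -/
def WR (d : ℕ) {q : ℕ} (z : Fin q → ℝ≥0) (Q : Fin q → Measure ℝ≥0) :
    Set (Measure (MultiConfig d q)) :=
  {P | IsProbabilityMeasure P ∧ IsStationary P ∧
    ∀ Λ : Set (EuclideanSpace ℝ (Fin d)), MeasurableSet Λ → Bornology.IsBounded Λ →
      (∀ᵐ ω ∂P, 0 < partitionFunction z Q Λ ω) ∧
      ∀ f : MultiConfig d q → ℝ, Measurable f → (∃ C : ℝ, ∀ ω, |f ω| ≤ C) →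
        ∫ ω, f ω ∂P = ∫ ω, ∫ ω', f (glue Λ ω' ω) ∂(specification z Q Λ ω) ∂P}

end WidomRowlinson

end

/-! The infinite `d`-th moment makes the set of marks `(x, r)` with `‖x‖ > R` and `r ≥ ‖x‖ + R` have
infinite intensity for colour `i`, for every `R`. Under the single-colour Poisson law, a bounded `Λ`
is therefore almost surely swallowed by one ball centred outside it (`intensity_coveringSet`,
`ae_isCovered`). With the other colours absent, a configuration put into `Λ` is then authorized
exactly when it uses only colour `i` (`glue_mem_authorized_iff`). Colours being independent,
conditioning on this leaves a free Poisson process of colour `i` (`exists_restrict_onlyColour`). So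
the specification amounts to Poisson resampling in `Λ`, which preserves the Poisson law; this gives
membership.

For extremality, a component `P₁` of a convex decomposition is absolutely continuous with respect to
the Poisson law, so it is covered almost surely as well. The DLR equation for `P₁` then makes its
restriction to every ball Poisson, and local events determine the law
(`eq_multiPoisson_single_of_mem_WR`).

Since `poissonLaw` is a choice with default value `0`, existence of the Poisson process has to be
established. Everything goes through the void probabilities `exp (-ν C)`: void events form a
generating π-system, hence determine the law (`ext_of_void`). Counts are recovered by counting
occupied cells of ever finer partitions, and generating functions show that they are Poisson
(`HasVoidProb.isPoissonProcess`). This uses that the intensity has no atoms, which follows from `d ≥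
1`. -/

noncomputable section

namespace WidomRowlinson

open Config Filter Topology

variable {d q : ℕ}

/-! ### Void events and the σ-algebra of configurations -/

namespace Config

/-- The event that a configuration has no point in `B`. -/
def void (B : Set (State d)) : Set (Config d) := {ω | ω.carrier ∩ B = ∅}

theorem mem_void {B : Set (State d)} {ω : Config d} : ω ∈ void B ↔ ω.carrier ∩ B = ∅ := Iff.rfl

theorem mem_void' {B : Set (State d)} {ω : Config d} :
    ω ∈ void B ↔ ∀ X ∈ ω.carrier, X ∉ B := by
  rw [mem_void, ← disjoint_iff_inter_eq_empty, disjoint_left]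

theorem void_eq_preimage (B : Set (State d)) : void B = count B ⁻¹' {0} := by
  ext ω; simp [void, count]

theorem measurable_count {B : Set (State d)} (hB : MeasurableSet B) :
    Measurable (count B : Config d → ℕ∞) := by
  refine Measurable.mono (comap_measurable (count B)) ?_ le_rfl
  exact le_iSup₂_of_le (f := fun (B : Set (State d)) (_ : MeasurableSet B) =>
    MeasurableSpace.comap (count B) (inferInstance : MeasurableSpace ℕ∞)) B hB le_rfl

theorem measurableSet_void {B : Set (State d)} (hB : MeasurableSet B) :
    MeasurableSet (void B) := by
  rw [void_eq_preimage]
  exact measurable_count hB (measurableSet_singleton 0)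

theorem void_empty : void (∅ : Set (State d)) = univ := by ext; simp [void]

theorem void_union (B C : Set (State d)) : void (B ∪ C) = void B ∩ void C := by
  ext ω; simp [void, inter_union_distrib_left]

theorem void_iUnion {ι : Sort*} (B : ι → Set (State d)) : void (⋃ k, B k) = ⋂ k, void (B k) := by
  ext ω; simp [void, inter_iUnion]

theorem void_anti {B C : Set (State d)} (h : B ⊆ C) : void C ⊆ void B :=
  fun _ hω => subset_eq_empty (inter_subset_inter_right _ h) hω

/-- The marked points whose first `n` binary digits, in a fixed measurable encoding of the state
space in Cantor space, are given by `v`. -/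
def cell (n : ℕ) (v : Fin n → Bool) : Set (State d) :=
  {x | ∀ k : Fin n, MeasurableSpace.mapNatBool (State d) x k = v k}

theorem measurableSet_cell (n : ℕ) (v : Fin n → Bool) :
    MeasurableSet (cell n v : Set (State d)) := by
  rw [cell, ofPred_forall]
  refine MeasurableSet.iInter fun k => ?_
  exact (measurable_pi_iff.1 (MeasurableSpace.measurable_mapNatBool (State d)) k)
    (measurableSet_singleton (v k))

theorem disjoint_cell (n : ℕ) {v w : Fin n → Bool} (h : v ≠ w) :
    Disjoint (cell n v : Set (State d)) (cell n w) :=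
  disjoint_left.2 fun _ hv hw => h (funext fun k => (hv k).symm.trans (hw k))

theorem iUnion_cell (n : ℕ) : ⋃ v, (cell n v : Set (State d)) = univ :=
  eq_univ_of_forall fun x => mem_iUnion.2 ⟨fun k => MeasurableSpace.mapNatBool (State d) x k,
    fun _ => rfl⟩

/-- The code of the cell of level `n` containing `x`. -/
def code (n : ℕ) (x : State d) : Fin n → Bool := fun k => MeasurableSpace.mapNatBool (State d) x k

theorem mem_cell_iff {n : ℕ} {v : Fin n → Bool} {x : State d} : x ∈ cell n v ↔ code n x = v :=
  funext_iff.symm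

theorem code_ne_of_le {m n : ℕ} (h : m ≤ n) {x y : State d} (hxy : code m x ≠ code m y) :
    code n x ≠ code n y := fun he => hxy <| funext fun k => congrFun he (Fin.castLE h k)

theorem exists_code_ne {x y : State d} (h : x ≠ y) : ∃ n, code n x ≠ code n y := by
  by_contra! hc
  refine h (MeasurableSpace.injective_mapNatBool (State d) (funext fun k => ?_))
  exact congrFun (hc (k + 1)) ⟨k, k.lt_succ_self⟩

open Classical in
/-- The number of cells of level `n` in which the configuration has a point of `B`. -/
def hits (B : Set (State d)) (n : ℕ) (ω : Config d) : ℕ :=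
  ∑ v : Fin n → Bool, if ω ∈ void (B ∩ cell n v) then 0 else 1

theorem hits_eq_encard (B : Set (State d)) (n : ℕ) (ω : Config d) :
    (hits B n ω : ℕ∞) = (code n '' (ω.carrier ∩ B)).encard := by
  classical
  have h : code n '' (ω.carrier ∩ B) =
      ((Finset.univ.filter fun v => ω ∉ void (B ∩ cell n v) : Finset (Fin n → Bool)) :
        Set (Fin n → Bool)) := by
    ext v
    simp only [mem_image, Finset.coe_filter, Finset.mem_univ, true_and, mem_ofPred_eq, mem_void']
    push Not
    exact ⟨fun ⟨x, hx, hv⟩ => ⟨x, hx.1, hx.2, mem_cell_iff.2 hv⟩,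
      fun ⟨x, hx, hB, hv⟩ => ⟨x, ⟨hx, hB⟩, mem_cell_iff.1 hv⟩⟩
  rw [h, encard_coe_eq_coe_finsetCard, Finset.card_filter, hits]
  congr 1
  refine Finset.sum_congr rfl fun v _ => ?_
  split_ifs <;> simp_all

theorem hits_le_count (B : Set (State d)) (n : ℕ) (ω : Config d) :
    (hits B n ω : ℕ∞) ≤ count B ω := by
  rw [hits_eq_encard]; exact encard_image_le _ _

/-- Codes of level `m` are truncations of codes of level `n`, and taking an image cannot increase
cardinality. -/
theorem hits_mono (B : Set (State d)) (ω : Config d) : Monotone fun n => hits B n ω := by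
  intro m n h
  have : code m '' (ω.carrier ∩ B) =
      (fun v : Fin n → Bool => fun k => v (Fin.castLE h k)) '' (code n '' (ω.carrier ∩ B)) := by
    rw [image_image]; rfl
  have h2 : (hits B m ω : ℕ∞) ≤ hits B n ω := by
    rw [hits_eq_encard, hits_eq_encard, this]
    exact encard_image_le _ _
  exact_mod_cast h2

/-- The encoding is injective, so finitely many points have distinct codes from some level on. -/
theorem exists_le_hits {B : Set (State d)} {ω : Config d} {m : ℕ} (h : (m : ℕ∞) ≤ count B ω) :
    ∃ n, m ≤ hits B n ω := by
  obtain ⟨t, ht, htm⟩ := exists_subset_encard_eq h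
  have hfin : t.Finite := finite_of_encard_eq_coe htm
  have hsep : ∃ n, InjOn (code n) t := by
    have h1 : ∀ p ∈ t ×ˢ t, ∃ n, p.1 ≠ p.2 → code n p.1 ≠ code n p.2 := fun p _ => by
      by_cases hp : p.1 = p.2
      · exact ⟨0, fun h => absurd hp h⟩
      · obtain ⟨n, hn⟩ := exists_code_ne hp
        exact ⟨n, fun _ => hn⟩
    choose! N hN using h1
    obtain ⟨M, hM⟩ := ((hfin.prod hfin).image N).bddAbove
    refine ⟨M, fun x hx y hy hxy => ?_⟩
    by_contra hne
    exact code_ne_of_le (hM ⟨(x, y), ⟨hx, hy⟩, rfl⟩) (hN (x, y) ⟨hx, hy⟩ hne) hxy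
  obtain ⟨n, hn⟩ := hsep
  refine ⟨n, ?_⟩
  have : (m : ℕ∞) ≤ hits B n ω := by
    rw [hits_eq_encard, ← htm, ← hn.encard_image]
    exact encard_le_encard (image_mono ht)
  exact_mod_cast this

theorem le_count_iff {B : Set (State d)} {ω : Config d} {m : ℕ} :
    (m : ℕ∞) ≤ count B ω ↔ ∃ n, m ≤ hits B n ω :=
  ⟨exists_le_hits, fun ⟨n, hn⟩ => (Nat.cast_le.2 hn).trans (hits_le_count B n ω)⟩

/-- The events that a measurable subset of `B` is void. -/
def voidEvents (B : Set (State d)) : Set (Set (Config d)) :=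
  {A | ∃ C, MeasurableSet C ∧ C ⊆ B ∧ A = void C}

theorem measurable_hits {m : MeasurableSpace (Config d)} {B : Set (State d)} {n : ℕ}
    (h : ∀ v, MeasurableSet[m] (void (B ∩ cell n v))) : Measurable[m] (hits B n) := by
  unfold hits
  refine Finset.measurable_sum _ fun v _ => ?_
  exact Measurable.ite (h v) measurable_const measurable_const

/-- The σ-algebra is left arbitrary for two uses: the σ-algebra of void events inside one `B`, which
yields independence of counts, and the comparison with the full σ-algebra. -/
theorem measurable_count_of_void {m : MeasurableSpace (Config d)} {B : Set (State d)}
    (h : ∀ n v, MeasurableSet[m] (void (B ∩ cell n v))) : Measurable[m] (count B) := by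
  have hle : ∀ k : ℕ, MeasurableSet[m] {ω | (k : ℕ∞) ≤ count B ω} := fun k => by
    simp only [le_count_iff, ofPred_exists]
    exact MeasurableSet.iUnion fun n => measurable_hits (h n) (measurableSet_Ici (a := k))
  refine ENat.measurable_iff.2 fun k => ?_
  have : count B ⁻¹' {(k : ℕ∞)} =
      {ω | (k : ℕ∞) ≤ count B ω} \ {ω | ((k + 1 : ℕ) : ℕ∞) ≤ count B ω} := by
    ext ω
    simp only [mem_preimage, mem_singleton_iff, Set.mem_sdiff, mem_ofPred_eq, not_le]
    rw [Nat.cast_add, Nat.cast_one, ENat.lt_add_one_iff (ENat.natCast_ne_top k)]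
    exact ⟨fun h => ⟨h.ge, h.le⟩, fun h => le_antisymm h.2 h.1⟩
  rw [this]
  exact (hle k).diff (hle (k + 1))

theorem measurable_count_voidEvents {B : Set (State d)} (hB : MeasurableSet B) :
    Measurable[MeasurableSpace.generateFrom (voidEvents B)] (count B) :=
  measurable_count_of_void fun n v => MeasurableSpace.measurableSet_generateFrom
    ⟨_, hB.inter (measurableSet_cell n v), inter_subset_left, rfl⟩

theorem isPiSystem_voidEvents (B : Set (State d)) : IsPiSystem (voidEvents B) := by
  rintro _ ⟨C, hC, hCB, rfl⟩ _ ⟨C', hC', hCB', rfl⟩ _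
  exact ⟨C ∪ C', hC.union hC', union_subset hCB hCB', (void_union C C').symm⟩

/-- The measurable sets of marked points whose centres lie in some ball. -/
def IsLocal (C : Set (State d)) : Prop :=
  MeasurableSet C ∧ ∃ m : ℕ, C ⊆ Metric.ball 0 m ×ˢ univ

/-- The events that a bounded measurable set is void. -/
def localVoidEvents (d : ℕ) : Set (Set (Config d)) := {A | ∃ C, IsLocal C ∧ A = void C}

theorem IsLocal.union {C C' : Set (State d)} (hC : IsLocal C) (hC' : IsLocal C') :
    IsLocal (C ∪ C') := by
  obtain ⟨h, m, hm⟩ := hC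
  obtain ⟨h', m', hm'⟩ := hC'
  refine ⟨h.union h', max m m', union_subset (hm.trans ?_) (hm'.trans ?_)⟩ <;>
  · refine prod_mono_left (Metric.ball_subset_ball ?_)
    simp

theorem isPiSystem_localVoidEvents : IsPiSystem (localVoidEvents d) := by
  rintro _ ⟨C, hC, rfl⟩ _ ⟨C', hC', rfl⟩ _
  exact ⟨C ∪ C', hC.union hC', (void_union C C').symm⟩

theorem iUnion_inter_ball (C : Set (State d)) : ⋃ m : ℕ, C ∩ Metric.ball 0 m ×ˢ univ = C := by
  rw [← inter_iUnion, inter_eq_left]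
  intro x _
  obtain ⟨m, hm⟩ := exists_nat_gt (dist x.1 0)
  exact mem_iUnion.2 ⟨m, hm, trivial⟩

theorem isLocal_inter_ball {C : Set (State d)} (hC : MeasurableSet C) (m : ℕ) :
    IsLocal (C ∩ Metric.ball 0 m ×ˢ univ) :=
  ⟨hC.inter (Metric.isOpen_ball.measurableSet.prod .univ), m, inter_subset_right⟩

theorem isLocal_inter_prod {C : Set (State d)} (hC : MeasurableSet C)
    {Λ : Set (EuclideanSpace ℝ (Fin d))} (hΛ : MeasurableSet Λ) (hb : Bornology.IsBounded Λ) :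
    IsLocal (C ∩ Λ ×ˢ univ) := by
  obtain ⟨R, hR⟩ := hb.subset_ball 0
  obtain ⟨m, hm⟩ := exists_nat_gt R
  exact ⟨hC.inter (hΛ.prod .univ), m, inter_subset_right.trans
    (prod_mono_left (hR.trans (Metric.ball_subset_ball hm.le)))⟩

theorem measurableSet_void_of_local {m : MeasurableSpace (Config d)}
    (h : ∀ C : Set (State d), IsLocal C → MeasurableSet[m] (void C))
    {C : Set (State d)} (hC : MeasurableSet C) : MeasurableSet[m] (void C) := by
  rw [← iUnion_inter_ball C, void_iUnion]
  exact MeasurableSet.iInter fun m => h _ (isLocal_inter_ball hC m)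

theorem instMeasurableSpace_le {m : MeasurableSpace (Config d)}
    (h : ∀ C : Set (State d), IsLocal C → MeasurableSet[m] (void C)) :
    instMeasurableSpace ≤ m := by
  refine iSup₂_le fun B hB => ?_
  rw [← measurable_iff_comap_le]
  exact measurable_count_of_void fun n v =>
    measurableSet_void_of_local h (hB.inter (measurableSet_cell n v))

/-- Together with `isPiSystem_localVoidEvents`, this lets laws be compared, and maps be tested for
measurability, on bounded void events alone. -/
theorem generateFrom_localVoidEvents :
    MeasurableSpace.generateFrom (localVoidEvents d) = instMeasurableSpace := by
  refine le_antisymm (MeasurableSpace.generateFrom_le ?_) (instMeasurableSpace_le fun C hC =>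
    MeasurableSpace.measurableSet_generateFrom ⟨C, hC, rfl⟩)
  rintro _ ⟨C, hC, rfl⟩
  exact measurableSet_void hC.1

theorem measurable_of_void {α : Type*} [MeasurableSpace α] {f : α → Config d}
    (h : ∀ C : Set (State d), IsLocal C → MeasurableSet (f ⁻¹' void C)) : Measurable f := by
  rw [← generateFrom_localVoidEvents]
  refine measurable_generateFrom ?_
  rintro _ ⟨C, hC, rfl⟩
  exact h C hC

theorem univ_mem_localVoidEvents : univ ∈ localVoidEvents d :=
  ⟨∅, ⟨.empty, 0, empty_subset _⟩, void_empty.symm⟩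

end Config

/-! ### Void probabilities determine the law -/

/-- `P` is a probability measure under which every bounded measurable set `C` is void with
probability `exp (-ν C)`. -/
structure HasVoidProb (ν : Measure (State d)) (P : Measure (Config d)) : Prop where
  isProbabilityMeasure : IsProbabilityMeasure P
  void_local : ∀ C : Set (State d), IsLocal C → ν C ≠ ∞ ∧
    P (void C) = ENNReal.ofReal (Real.exp (-(ν C).toReal))

theorem HasVoidProb.tendsto_measure_void {ν : Measure (State d)} {P : Measure (Config d)}
    (h : HasVoidProb ν P) {C : Set (State d)} (hC : MeasurableSet C) :
    Tendsto (fun m : ℕ => ENNReal.ofReal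
      (Real.exp (-(ν (C ∩ Metric.ball 0 m ×ˢ univ)).toReal))) atTop (𝓝 (P (void C))) := by
  have := h.isProbabilityMeasure
  have h1 : Tendsto (fun m : ℕ => P (void (C ∩ Metric.ball 0 m ×ˢ univ))) atTop
      (𝓝 (P (⋂ m : ℕ, void (C ∩ Metric.ball 0 m ×ˢ univ)))) := by
    refine tendsto_measure_iInter_atTop (fun m => ?_) ?_ ⟨0, measure_ne_top _ _⟩
    · exact (measurableSet_void (isLocal_inter_ball hC m).1).nullMeasurableSet
    · intro m n hmn
      exact void_anti (inter_subset_inter_right _ (prod_mono_left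
        (Metric.ball_subset_ball (Nat.cast_le.2 hmn))))
  rw [← void_iUnion, iUnion_inter_ball] at h1
  refine h1.congr fun m => (h.void_local _ (isLocal_inter_ball hC m)).2

theorem tendsto_measure_inter_ball (ν : Measure (State d)) (C : Set (State d)) :
    Tendsto (fun m : ℕ => ν (C ∩ Metric.ball 0 m ×ˢ univ)) atTop (𝓝 (ν C)) := by
  conv_rhs => rw [← iUnion_inter_ball C]
  refine tendsto_measure_iUnion_atTop ?_
  intro m n hmn
  exact inter_subset_inter_right _ (prod_mono_left (Metric.ball_subset_ball (Nat.cast_le.2 hmn)))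

theorem HasVoidProb.measure_void {ν : Measure (State d)} {P : Measure (Config d)}
    (h : HasVoidProb ν P) {C : Set (State d)} (hC : MeasurableSet C) (hν : ν C ≠ ∞) :
    P (void C) = ENNReal.ofReal (Real.exp (-(ν C).toReal)) := by
  refine tendsto_nhds_unique (h.tendsto_measure_void hC) ?_
  refine ENNReal.tendsto_ofReal ((Real.continuous_exp.tendsto _).comp ?_)
  exact ((ENNReal.tendsto_toReal hν).comp (tendsto_measure_inter_ball ν C)).neg

theorem HasVoidProb.measureReal_void {ν : Measure (State d)} {P : Measure (Config d)}
    (h : HasVoidProb ν P) {C : Set (State d)} (hC : MeasurableSet C) (hν : ν C ≠ ∞) :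
    P.real (void C) = Real.exp (-ν.real C) := by
  rw [measureReal_def, h.measure_void hC hν,
    ENNReal.toReal_ofReal (Real.exp_nonneg _), measureReal_def]

/-- The intensities of the truncations of `C` to balls increase to `∞`, so their void probabilities
tend to `0`. This is what will make a covering grain almost sure. -/
theorem HasVoidProb.measure_void_of_eq_top {ν : Measure (State d)} {P : Measure (Config d)}
    (h : HasVoidProb ν P) {C : Set (State d)} (hC : MeasurableSet C) (hν : ν C = ∞) :
    P (void C) = 0 := by
  refine tendsto_nhds_unique (h.tendsto_measure_void hC) ?_
  rw [← ENNReal.ofReal_zero]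
  refine ENNReal.tendsto_ofReal (Real.tendsto_exp_atBot.comp (tendsto_neg_atTop_atBot.comp ?_))
  refine tendsto_atTop.2 fun b => ?_
  have := tendsto_measure_inter_ball ν C
  rw [hν] at this
  filter_upwards [this.eventually (lt_mem_nhds (ENNReal.ofReal_lt_top (r := b)))] with m hm
  exact (ENNReal.ofReal_le_iff_le_toReal (h.void_local _ (isLocal_inter_ball hC m)).1).1 hm.le

/-- Laws of configurations with the same void probabilities coincide (Rényi). -/
theorem ext_of_void {P P' : Measure (Config d)} [IsProbabilityMeasure P] [IsProbabilityMeasure P']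
    (h : ∀ C : Set (State d), IsLocal C → P (void C) = P' (void C)) : P = P' := by
  refine ext_of_generate_finite (localVoidEvents d) generateFrom_localVoidEvents.symm
    isPiSystem_localVoidEvents ?_ (by simp)
  rintro _ ⟨C, hC, rfl⟩
  exact h C hC

/-! ### From void probabilities to independent Poisson counts -/

/-- The sum is the `μ ⊗ μ` mass of the pairs with equal codes of level `n`. These sets decrease to
the diagonal, which is null by Fubini because `μ` has no atoms. -/
theorem tendsto_sum_measure_cell_sq (μ : Measure (State d)) [IsFiniteMeasure μ]
    (hμ : ∀ x, μ {x} = 0) :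
    Tendsto (fun n : ℕ => ∑ v : Fin n → Bool, μ.real (cell n v) ^ 2) atTop (𝓝 0) := by
  have hset : ∀ n : ℕ, {p : State d × State d | code n p.1 = code n p.2} =
      ⋃ v : Fin n → Bool, cell n v ×ˢ cell n v := fun n => by
    ext ⟨x, y⟩
    simp only [mem_ofPred_eq, mem_iUnion, mem_prod, mem_cell_iff]
    exact ⟨fun h => ⟨_, rfl, h.symm⟩, fun ⟨v, h, h'⟩ => h.trans h'.symm⟩
  have hmeas : ∀ n : ℕ, MeasurableSet {p : State d × State d | code n p.1 = code n p.2} :=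
      fun n => by
    rw [hset]
    exact MeasurableSet.iUnion fun v => (measurableSet_cell n v).prod (measurableSet_cell n v)
  have h1 : Tendsto (fun n : ℕ => (μ.prod μ) {p | code n p.1 = code n p.2}) atTop
      (𝓝 ((μ.prod μ) (⋂ n : ℕ, {p | code n p.1 = code n p.2}))) := by
    refine tendsto_measure_iInter_atTop (fun n => (hmeas n).nullMeasurableSet) ?_
      ⟨0, measure_ne_top _ _⟩
    intro m n hmn p hp
    by_contra hne
    exact code_ne_of_le hmn hne hp
  have h0 : (μ.prod μ) (⋂ n : ℕ, {p | code n p.1 = code n p.2}) = 0 := by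
    rw [Measure.prod_apply (MeasurableSet.iInter hmeas)]
    refine (lintegral_congr fun x => ?_).trans lintegral_zero
    refine measure_mono_null (t := {x}) (fun y hy => ?_) (hμ x)
    by_contra hne
    obtain ⟨n, hn⟩ := exists_code_ne (Ne.symm hne)
    exact hn (mem_iInter.1 hy n)
  rw [h0] at h1
  have h2 := (ENNReal.tendsto_toReal ENNReal.zero_ne_top).comp h1
  rw [ENNReal.toReal_zero] at h2
  refine h2.congr fun n => ?_
  rw [Function.comp_apply, hset, ← measureReal_def, measureReal_iUnion_fintype]
  · refine Finset.sum_congr rfl fun v _ => ?_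
    rw [measureReal_prod_prod, sq]
  · intro v w hvw
    exact Disjoint.set_prod_left (disjoint_cell n hvw) _ _
  · exact fun v => (measurableSet_cell n v).prod (measurableSet_cell n v)

/-- A cell contributes the factor `(1 - s) 1_void + s`, equal to `1` if it is void and to `s` if it
is hit. Expanding the product leaves void probabilities of unions of cells; these factor by
disjointness, and the expansion is then undone. -/
theorem HasVoidProb.integral_pow_hits {ν : Measure (State d)} {P : Measure (Config d)}
    (h : HasVoidProb ν P) {B : Set (State d)} (hB : MeasurableSet B) (hν : ν B ≠ ∞) (n : ℕ)
    (s : ℝ) :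
    ∫ ω, s ^ hits B n ω ∂P =
      ∏ v : Fin n → Bool, ((1 - s) * Real.exp (-(ν.restrict B).real (cell n v)) + s) := by
  classical
  have := h.isProbabilityMeasure
  have hmc : ∀ v : Fin n → Bool, MeasurableSet (B ∩ cell n v) := fun v =>
    hB.inter (measurableSet_cell n v)
  have h1 : ∀ ω, s ^ hits B n ω = ∑ T ∈ (Finset.univ : Finset (Fin n → Bool)).powerset,
      (1 - s) ^ T.card * s ^ (Finset.univ \ T).card *
        (Config.void (⋃ v ∈ T, B ∩ cell n v)).indicator 1 ω := fun ω => by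
    have h2 : s ^ hits B n ω = ∏ v : Fin n → Bool,
        ((1 - s) * (Config.void (B ∩ cell n v)).indicator (1 : Config d → ℝ) ω + s) := by
      rw [hits, ← Finset.prod_pow_eq_pow_sum]
      refine Finset.prod_congr rfl fun v _ => ?_
      by_cases hv : ω ∈ Config.void (B ∩ cell n v) <;> simp [hv]
    rw [h2, Finset.prod_add]
    refine Finset.sum_congr rfl fun T _ => ?_
    rw [Finset.prod_mul_distrib, Finset.prod_const, Finset.prod_const, mul_right_comm]
    congr 1
    simp only [void_iUnion]
    by_cases hT : ∀ v ∈ T, ω ∈ Config.void (B ∩ cell n v)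
    · rw [indicator_of_mem (by simpa using hT)]
      exact Finset.prod_eq_one fun v hv => indicator_of_mem (hT v hv) _
    · rw [indicator_of_notMem (by simpa using hT)]
      push Not at hT
      obtain ⟨v, hv, hvT⟩ := hT
      exact Finset.prod_eq_zero hv (indicator_of_notMem hvT _)
  have hU : ∀ T : Finset (Fin n → Bool), MeasurableSet (⋃ v ∈ T, B ∩ cell n v) := fun T =>
    Finset.measurableSet_biUnion _ fun v _ => hmc v
  have hPU : ∀ T : Finset (Fin n → Bool), P.real (Config.void (⋃ v ∈ T, B ∩ cell n v)) =
      ∏ v ∈ T, Real.exp (-(ν.restrict B).real (cell n v)) := fun T => by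
    rw [h.measureReal_void (hU T)
        (measure_ne_top_of_subset (iUnion₂_subset fun _ _ => inter_subset_left) hν),
      ← Real.exp_sum, Finset.sum_neg_distrib, measureReal_biUnion_finset]
    · congr 2
      refine Finset.sum_congr rfl fun v _ => ?_
      rw [measureReal_restrict_apply (measurableSet_cell n v), inter_comm]
    · intro v _ w _ hvw
      exact (disjoint_cell n hvw).mono inter_subset_right inter_subset_right
    · exact fun v _ => hmc v
  simp_rw [h1]
  rw [integral_finsetSum, Finset.prod_add]
  · refine Finset.sum_congr rfl fun T _ => ?_
    rw [integral_const_mul, integral_indicator_one (measurableSet_void (hU T)), hPU,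
      Finset.prod_mul_distrib, Finset.prod_const, Finset.prod_const, mul_right_comm]
  · intro T _
    exact ((integrable_const (1 : ℝ)).indicator (measurableSet_void (hU T))).const_mul _

theorem tendsto_prod_cell (μ : Measure (State d)) [IsFiniteMeasure μ]
    (hμ : ∀ x, μ {x} = 0) {s : ℝ} (hs0 : 0 ≤ s) (hs1 : s ≤ 1) :
    Tendsto (fun n : ℕ => ∏ v : Fin n → Bool, ((1 - s) * Real.exp (-μ.real (cell n v)) + s)) atTop
      (𝓝 (Real.exp (-((1 - s) * μ.real univ)))) := by
  have hsum : ∀ n : ℕ, ∑ v : Fin n → Bool, μ.real (cell n v) = μ.real univ := fun n => by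
    rw [← iUnion_cell n, measureReal_iUnion_fintype (fun v w => disjoint_cell n)
      (measurableSet_cell n)]
  -- The product lies between the limit and the limit multiplied by an exponential of the vanishing
  -- sum of squares.
  refine tendsto_of_tendsto_of_tendsto_of_le_of_le tendsto_const_nhds
    (h := fun n : ℕ => Real.exp (-((1 - s) * μ.real univ) +
      (1 - s) * ∑ v : Fin n → Bool, μ.real (cell n v) ^ 2)) ?_ ?_ ?_
  · have := ((tendsto_sum_measure_cell_sq μ hμ).const_mul (1 - s)).const_add
      (-((1 - s) * μ.real univ))
    rw [mul_zero, add_zero] at this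
    exact (Real.continuous_exp.tendsto _).comp this
  · intro n
    show Real.exp (-((1 - s) * μ.real univ)) ≤ _
    rw [← hsum n, Finset.mul_sum, ← Finset.sum_neg_distrib, Real.exp_sum]
    refine Finset.prod_le_prod (fun v _ => Real.exp_nonneg _) fun v _ => ?_
    -- Convexity of `exp` between `-u` and `0`, with weights `1 - s` and `s`.
    have := convexOn_exp.2 (mem_univ (-μ.real (cell n v))) (mem_univ 0)
      (sub_nonneg.2 hs1) hs0 (by ring)
    simpa using this
  · intro n
    show _ ≤ Real.exp (-((1 - s) * μ.real univ) + _)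
    rw [← hsum n, Finset.mul_sum, Finset.mul_sum, ← Finset.sum_neg_distrib,
      ← Finset.sum_add_distrib, Real.exp_sum]
    refine Finset.prod_le_prod (fun v _ => ?_) fun v _ => ?_
    · have := sub_nonneg.2 hs1
      positivity
    · set u := μ.real (cell n v) with hu
      have hu0 : 0 ≤ u := measureReal_nonneg
      -- This follows from `exp (-u) ≤ 1 / (1 + u)` and `(1 + u) (1 - u + u ^ 2) = 1 + u ^ 3 ≥ 1`.
      have h1 : Real.exp (-u) ≤ 1 - u + u ^ 2 := by
        have h2 : 1 + u ≤ Real.exp u := by linarith [Real.add_one_le_exp u]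
        rw [Real.exp_neg]
        have h3 : (Real.exp u)⁻¹ ≤ (1 + u)⁻¹ := inv_anti₀ (by linarith) h2
        refine h3.trans ?_
        rw [inv_le_iff_one_le_mul₀ (by linarith)]
        nlinarith [pow_nonneg hu0 3]
      have h4 := Real.add_one_le_exp (-((1 - s) * u) + (1 - s) * u ^ 2)
      have h5 := mul_le_mul_of_nonneg_left h1 (sub_nonneg.2 hs1)
      linarith

/-- The function `k ↦ s ^ k` on `ℕ∞`, with value `0` at `∞`. -/
def natPow (s : ℝ) (k : ℕ∞) : ℝ := if k = ⊤ then 0 else s ^ k.toNat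

/-- The number of occupied cells either stabilises at a finite count or diverges; in the latter case
the limit is the value `0` chosen for `natPow` at `⊤`. -/
theorem tendsto_pow_hits (B : Set (State d)) (ω : Config d) {s : ℝ} (hs0 : 0 ≤ s) (hs1 : s < 1) :
    Tendsto (fun n => s ^ hits B n ω) atTop (𝓝 (natPow s (count B ω))) := by
  rw [natPow]
  split_ifs with ht
  · refine (tendsto_pow_atTop_nhds_zero_of_lt_one hs0 hs1).comp ?_
    refine tendsto_atTop_atTop.2 fun m => ?_
    obtain ⟨n, hn⟩ := exists_le_hits (m := m) (ht ▸ le_top : (m : ℕ∞) ≤ count B ω)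
    exact ⟨n, fun n' h => hn.trans (hits_mono B ω h)⟩
  · obtain ⟨k, hk⟩ := ENat.ne_top_iff_exists.1 ht
    obtain ⟨n, hn⟩ := exists_le_hits hk.le
    refine tendsto_const_nhds.congr' ?_
    filter_upwards [eventually_ge_atTop n] with n' hn'
    have h1 : hits B n' ω ≤ k := by
      have := hits_le_count B n' ω
      rw [← hk] at this
      exact_mod_cast this
    rw [← hk, ENat.toNat_natCast, le_antisymm h1 (hn.trans (hits_mono B ω hn'))]

theorem HasVoidProb.integral_natPow_count {ν : Measure (State d)} {P : Measure (Config d)}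
    (h : HasVoidProb ν P) (hν0 : ∀ x, ν {x} = 0) {B : Set (State d)} (hB : MeasurableSet B)
    (hν : ν B ≠ ∞) {s : ℝ} (hs0 : 0 ≤ s) (hs1 : s < 1) :
    ∫ ω, natPow s (count B ω) ∂P = Real.exp (-((1 - s) * ν.real B)) := by
  have := h.isProbabilityMeasure
  have hfin : IsFiniteMeasure (ν.restrict B) := ⟨by simpa using hν.lt_top⟩
  have h1 := tendsto_prod_cell (ν.restrict B)
    (fun x => le_antisymm ((Measure.restrict_apply_le _ _).trans (hν0 x).le) zero_le) hs0 hs1.le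
  simp only [← h.integral_pow_hits hB hν, measureReal_restrict_apply_univ] at h1
  refine tendsto_nhds_unique ?_ h1
  refine tendsto_integral_of_dominated_convergence (fun _ => 1) (fun n => ?_)
    (integrable_const _) (fun n => ae_of_all _ fun ω => ?_)
    (ae_of_all _ fun ω => tendsto_pow_hits B ω hs0 hs1)
  · exact (measurable_from_nat (f := fun k => s ^ k)).comp (measurable_hits fun v =>
      measurableSet_void (hB.inter (measurableSet_cell n v))) |>.aestronglyMeasurable
  · rw [Real.norm_of_nonneg (by positivity)]
    exact pow_le_one₀ hs0 hs1.le

/-- Bounded power series which agree on `(0, 1)` have the same coefficients. -/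
theorem eq_of_tsum_mul_pow_eq {a b : ℕ → ℝ} {C : ℝ} (ha : ∀ k, |a k| ≤ C) (hb : ∀ k, |b k| ≤ C)
    (h : ∀ s : ℝ, 0 < s → s < 1 → ∑' k, a k * s ^ k = ∑' k, b k * s ^ k) : a = b := by
  have hsum : ∀ (c : ℕ → ℝ) (D : ℝ), (∀ k, |c k| ≤ D) → ∀ s : ℝ, 0 < s → s < 1 →
      Summable fun k => c k * s ^ k := fun c D hc s hs0 hs1 => by
    refine Summable.of_norm_bounded ((summable_geometric_of_lt_one hs0.le hs1).mul_left D)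
      fun k => ?_
    rw [norm_mul, Real.norm_eq_abs, Real.norm_of_nonneg (by positivity)]
    exact mul_le_mul_of_nonneg_right (hc k) (by positivity)
  by_contra hne
  have hex : ∃ k, a k - b k ≠ 0 := by
    by_contra! hc
    exact hne (funext fun k => sub_eq_zero.1 (hc k))
  classical
  set c : ℕ → ℝ := fun k => a k - b k with hc
  have hcb : ∀ k, |c k| ≤ 2 * C := fun k => (abs_sub _ _).trans (by linarith [ha k, hb k])
  set m := Nat.find hex with hm
  have hm0 : c m ≠ 0 := Nat.find_spec hex
  have hlt : ∀ k < m, c k = 0 := fun k hk => not_not.1 (Nat.find_min hex hk)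
  -- Dividing the difference series by `s ^ m`, with `m` the first index of disagreement, leaves `c
  -- m` plus `s` times a remainder bounded for `s < 1 / 2`; letting `s → 0` forces `c m = 0`.
  have hz : ∀ s : ℝ, 0 < s → s < 1 → c m + s * ∑' k, c (k + (m + 1)) * s ^ k = 0 :=
    fun s hs0 hs1 => by
      have h0 : ∑' k, c k * s ^ k = 0 := by
        simp only [hc, sub_mul]
        rw [(hsum a C ha s hs0 hs1).tsum_sub (hsum b C hb s hs0 hs1), h s hs0 hs1, sub_self]
      rw [← (hsum c _ hcb s hs0 hs1).sum_add_tsum_nat_add (m + 1), Finset.sum_range_succ,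
        Finset.sum_eq_zero fun k hk => by rw [hlt k (Finset.mem_range.1 hk), zero_mul],
        zero_add] at h0
      have h1 : ∑' k, c (k + (m + 1)) * s ^ (k + (m + 1)) =
          s ^ m * (s * ∑' k, c (k + (m + 1)) * s ^ k) := by
        rw [← mul_assoc, ← tsum_mul_left]
        exact tsum_congr fun k => by ring
      rw [h1, mul_comm, ← mul_add] at h0
      exact (mul_eq_zero.1 h0).resolve_left (by positivity)
  have hle : ∀ s : ℝ, 0 < s → s < 1 / 2 → |c m| ≤ s * (4 * C) := fun s hs0 hs1 => by
    have h1 : |∑' k, c (k + (m + 1)) * s ^ k| ≤ 4 * C := by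
      have hg := (hasSum_geometric_of_lt_one hs0.le (by linarith : s < 1)).mul_left (2 * C)
      refine (tsum_of_norm_bounded (f := fun k => c (k + (m + 1)) * s ^ k) hg fun k => ?_).trans ?_
      · rw [norm_mul, Real.norm_eq_abs, Real.norm_of_nonneg (by positivity)]
        exact mul_le_mul_of_nonneg_right (hcb _) (by positivity)
      · have hC : 0 ≤ C := (abs_nonneg _).trans (ha 0)
        have : (1 - s)⁻¹ ≤ 2 := by
          rw [inv_le_comm₀ (by linarith) (by norm_num)]; linarith
        nlinarith
    rw [eq_neg_of_add_eq_zero_left (hz s hs0 (by linarith)), abs_neg, abs_mul, abs_of_pos hs0]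
    exact mul_le_mul_of_nonneg_left h1 hs0.le
  have hlim : Tendsto (fun s : ℝ => s * (4 * C)) (𝓝[>] 0) (𝓝 0) := by
    have : Tendsto (fun s : ℝ => s * (4 * C)) (𝓝 0) (𝓝 (0 * (4 * C))) :=
      tendsto_id.mul_const _
    rw [zero_mul] at this
    exact this.mono_left nhdsWithin_le_nhds
  have : |c m| ≤ 0 := by
    refine ge_of_tendsto hlim ?_
    filter_upwards [Ioo_mem_nhdsGT (show (0 : ℝ) < 1 / 2 by norm_num)] with s hs
    exact hle s hs.1 hs.2
  exact hm0 (abs_nonpos_iff.1 this)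

theorem integral_natPow (κ : Measure ℕ∞) [IsProbabilityMeasure κ] {s : ℝ} (hs0 : 0 ≤ s)
    (hs1 : s < 1) : ∫ k, natPow s k ∂κ = ∑' k : ℕ, κ.real {(k : ℕ∞)} * s ^ k := by
  rw [integral_countable]
  · rw [← Function.Injective.tsum_eq (g := ((↑) : ℕ → ℕ∞)) Nat.cast_injective]
    · exact tsum_congr fun k => by simp [natPow]
    · intro k hk
      by_contra hkt
      refine hk ?_
      have : k = ⊤ := by
        by_contra hne
        exact hkt (ENat.ne_top_iff_exists.1 hne)
      simp [natPow, this]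
  · refine Integrable.of_bound (C := 1) (Measurable.of_discrete.aestronglyMeasurable)
      (ae_of_all _ fun k => ?_)
    rw [natPow]
    split_ifs
    · simp
    · rw [Real.norm_of_nonneg (by positivity)]
      exact pow_le_one₀ hs0 hs1.le

theorem integral_natPow_poisson (r : ℝ≥0) {s : ℝ} :
    ∫ k, natPow s k ∂((poissonMeasure r).map (fun n : ℕ => (n : ℕ∞))) =
      Real.exp (-((1 - s) * r)) := by
  rw [integral_map Measurable.of_discrete.aemeasurable
    Measurable.of_discrete.aestronglyMeasurable, integral_poissonMeasure]
  have h := (NormedSpace.expSeries_div_hasSum_exp (r * s : ℝ)).mul_left (Real.exp (-r))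
  rw [← Real.exp_eq_exp_ℝ, ← Real.exp_add] at h
  rw [show -((1 - s) * (r : ℝ)) = -r + r * s by ring, ← h.tsum_eq]
  refine tsum_congr fun k => ?_
  simp only [natPow, ENat.natCast_ne_top, if_false, ENat.toNat_natCast, smul_eq_mul, mul_pow]
  ring

/-- The power series gives the mass of each natural number; the mass of `⊤` follows because both
total masses are `1`. -/
theorem ext_of_integral_natPow {κ κ' : Measure ℕ∞} [IsProbabilityMeasure κ]
    [IsProbabilityMeasure κ']
    (h : ∀ s : ℝ, 0 < s → s < 1 → ∫ k, natPow s k ∂κ = ∫ k, natPow s k ∂κ') : κ = κ' := by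
  have hab : ∀ (κ : Measure ℕ∞) [IsProbabilityMeasure κ] (k : ℕ), |κ.real {(k : ℕ∞)}| ≤ 1 :=
    fun κ _ k => by
      rw [abs_of_nonneg measureReal_nonneg]
      exact measureReal_le_one
  have hcoef : (fun k : ℕ => κ.real {(k : ℕ∞)}) = fun k : ℕ => κ'.real {(k : ℕ∞)} := by
    refine eq_of_tsum_mul_pow_eq (hab κ) (hab κ') fun s hs0 hs1 => ?_
    rw [← integral_natPow κ hs0.le hs1, ← integral_natPow κ' hs0.le hs1, h s hs0 hs1]
  have hnat : ∀ k : ℕ, κ {(k : ℕ∞)} = κ' {(k : ℕ∞)} := fun k =>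
    (measureReal_eq_measureReal_iff).1 (congrFun hcoef k)
  refine Measure.ext_of_singleton fun k => ?_
  rcases eq_or_ne k ⊤ with rfl | hk
  · have htop : ({⊤} : Set ℕ∞) = (⋃ k : ℕ, {(k : ℕ∞)})ᶜ := by
      ext k
      simp only [mem_singleton_iff, mem_compl_iff, mem_iUnion, not_exists]
      exact ⟨fun h n => h ▸ (ENat.natCast_ne_top n).symm, fun h => by
        by_contra hne
        obtain ⟨n, hn⟩ := ENat.ne_top_iff_exists.1 hne
        exact h n hn.symm⟩
    have hdisj : Pairwise (Function.onFun Disjoint fun k : ℕ => ({(k : ℕ∞)} : Set ℕ∞)) := by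
      intro a b hab
      simpa [Function.onFun] using hab
    rw [htop, prob_compl_eq_one_sub (by measurability), prob_compl_eq_one_sub (by measurability),
      measure_iUnion hdisj (fun _ => by measurability),
      measure_iUnion hdisj (fun _ => by measurability)]
    simp only [hnat]
  · obtain ⟨n, rfl⟩ := ENat.ne_top_iff_exists.1 hk
    exact hnat n

/-- Each count has the Poisson generating function. For independence, the count of `B k` is
measurable with respect to the void events inside `B k`; these form π-systems, on which
probabilities factor because `ν` is additive over disjoint sets. -/
theorem HasVoidProb.isPoissonProcess {ν : Measure (State d)} {P : Measure (Config d)}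
    (h : HasVoidProb ν P) (hν0 : ∀ x, ν {x} = 0) : IsPoissonProcess ν P := by
  have := h.isProbabilityMeasure
  refine ⟨this, fun B hB hν => ?_, fun n B hB hν hdisj => ?_⟩
  · have := Measure.isProbabilityMeasure_map (μ := P) (measurable_count hB).aemeasurable
    refine ext_of_integral_natPow fun s hs0 hs1 => ?_
    rw [integral_natPow_poisson, integral_map (measurable_count hB).aemeasurable
      Measurable.of_discrete.aestronglyMeasurable,
      h.integral_natPow_count hν0 hB hν hs0.le hs1]
    rfl
  · rw [iIndepFun_iff_iIndep]
    have hind : iIndep (fun k => MeasurableSpace.generateFrom (voidEvents (B k))) P := by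
      refine iIndepSets.iIndep (fun k => MeasurableSpace.generateFrom_le ?_)
        (fun k => voidEvents (B k)) (fun k => isPiSystem_voidEvents (B k)) (fun k => rfl) ?_
      · rintro _ ⟨C, hC, -, rfl⟩
        exact measurableSet_void hC
      · rw [iIndepSets_iff]
        intro T f hf
        choose! C hC hCB hf using hf
        have hCν : ∀ k ∈ T, ν (C k) ≠ ∞ := fun k hk => measure_ne_top_of_subset (hCB k hk) (hν k)
        have hU : ⋂ k ∈ T, f k = Config.void (⋃ k ∈ T, C k) := by
          simp only [void_iUnion]
          exact iInter₂_congr hf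
        have hsum : ν (⋃ k ∈ T, C k) = ∑ k ∈ T, ν (C k) :=
          measure_biUnion_finset (fun k hk l hl hkl =>
            (hdisj hkl).mono (hCB k hk) (hCB l hl)) hC
        rw [hU, h.measure_void (Finset.measurableSet_biUnion _ hC)
          (hsum ▸ ENNReal.sum_ne_top.2 hCν), hsum, ENNReal.toReal_sum hCν,
          ← Finset.sum_neg_distrib, Real.exp_sum, ENNReal.ofReal_prod_of_nonneg
            fun _ _ => Real.exp_nonneg _]
        refine Finset.prod_congr rfl fun k hk => ?_
        rw [hf k hk, h.measure_void (hC k hk) (hCν k hk)]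
    refine (iIndep_iff _ _).2 fun T f hf => (iIndep_iff _ _).1 hind T fun k hk => ?_
    exact (measurable_iff_comap_le.1 (measurable_count_voidEvents (hB k))) _ (hf k hk)

theorem IsPoissonProcess.hasVoidProb {ν : Measure (State d)} {P : Measure (Config d)}
    (h : IsPoissonProcess ν P) (hν : ∀ C, IsLocal C → ν C ≠ ∞) : HasVoidProb ν P := by
  refine ⟨h.isProbabilityMeasure, fun C hC => ⟨hν C hC, ?_⟩⟩
  have h1 := congrArg (fun κ => κ {(0 : ℕ∞)}) (h.map_count C hC.1 (hν C hC))
  beta_reduce at h1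
  rw [Measure.map_apply (measurable_count hC.1) (measurableSet_singleton _), ← void_eq_preimage,
    Measure.map_apply Measurable.of_discrete (measurableSet_singleton _)] at h1
  rw [h1, show (fun n : ℕ => (n : ℕ∞)) ⁻¹' {0} = {0} by ext; simp, poissonMeasure_singleton]
  simp [ENNReal.coe_toNNReal_eq_toReal]

/-! ### Construction of the Poisson process -/

namespace Config

/-- The configuration formed by finitely many marked points. -/
def ofFin {N : ℕ} (x : Fin N → State d) : Config d where
  carrier := range x
  locallyFinite _ _ := (finite_range x).inter_of_left _

theorem ofFin_mem_void {N : ℕ} {x : Fin N → State d} {C : Set (State d)} :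
    ofFin x ∈ void C ↔ x ∈ univ.pi fun _ => Cᶜ := by
  simp [mem_void', ofFin]

theorem measurable_ofFin (N : ℕ) : Measurable (ofFin : (Fin N → State d) → Config d) := by
  refine measurable_of_void fun C hC => ?_
  have : (ofFin : (Fin N → State d) → Config d) ⁻¹' void C = univ.pi fun _ => Cᶜ := by
    ext x; exact ofFin_mem_void
  rw [this]
  exact MeasurableSet.univ_pi fun _ => hC.1.compl

/-- The marked points whose centre has norm in `[n, n + 1)`. -/
def shell (n : ℕ) : Set (State d) := {X | ⌊‖X.1‖⌋₊ = n}

theorem measurableSet_shell (n : ℕ) : MeasurableSet (shell n : Set (State d)) :=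
  (measurable_fst.norm.nat_floor) (measurableSet_singleton n)

theorem disjoint_shell {m n : ℕ} (h : m ≠ n) : Disjoint (shell m : Set (State d)) (shell n) :=
  disjoint_left.2 fun _ hm hn => h (hm.symm.trans hn)

theorem isLocal_shell (n : ℕ) : IsLocal (shell n : Set (State d)) := by
  refine ⟨measurableSet_shell n, n + 1, fun X hX => ⟨?_, trivial⟩⟩
  rw [mem_ball_zero_iff, ← (hX : ⌊‖X.1‖⌋₊ = n)]
  exact_mod_cast Nat.lt_floor_add_one ‖X.1‖

/-- The configuration which coincides with `ω n` on the shell number `n`. -/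
def merge (ω : ℕ → Config d) : Config d where
  carrier := ⋃ n, (ω n).carrier ∩ shell n
  locallyFinite Λ hΛ := by
    obtain ⟨R, hR⟩ := hΛ.subset_ball 0
    obtain ⟨m, hm⟩ := exists_nat_gt R
    refine ((finite_Iio (m + 1)).biUnion fun n _ => (ω n).locallyFinite Λ hΛ).subset ?_
    rintro X ⟨hX, hXΛ⟩
    obtain ⟨n, hn⟩ := mem_iUnion.1 hX
    refine mem_iUnion₂.2 ⟨n, ?_, hn.1, hXΛ⟩
    have h1 : ‖X.1‖ < m := (mem_ball_zero_iff.1 (hR hXΛ.1)).trans hm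
    have h2 : (n : ℝ) ≤ ‖X.1‖ := by
      rw [← (hn.2 : ⌊‖X.1‖⌋₊ = n)]
      exact Nat.floor_le (norm_nonneg _)
    have h3 : n < m := by exact_mod_cast h2.trans_lt h1
    exact mem_Iio.2 (by omega)

theorem merge_mem_void {ω : ℕ → Config d} {C : Set (State d)} :
    merge ω ∈ void C ↔ ∀ n, ω n ∈ void (C ∩ shell n) := by
  rw [mem_void, merge, iUnion_inter, iUnion_eq_empty]
  refine forall_congr' fun n => ?_
  rw [mem_void, inter_assoc, inter_comm (shell n)]

theorem measurable_merge : Measurable (merge : (ℕ → Config d) → Config d) := by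
  refine measurable_of_void fun C hC => ?_
  have : (merge : (ℕ → Config d) → Config d) ⁻¹' void C =
      ⋂ n, (fun ω => ω n) ⁻¹' void (C ∩ shell n) := by
    ext ω; simp only [mem_preimage, merge_mem_void, mem_iInter]
  rw [this]
  exact MeasurableSet.iInter fun n => measurable_pi_apply n
    (measurableSet_void (hC.1.inter (measurableSet_shell n)))

end Config

/-- A Poisson number of independent points is sampled. Keeping the product measures unnormalised,
with weights `exp (-ν univ) / N!`, avoids dividing by a total mass that may vanish. Coinciding
points merge, which does not affect void events. -/
theorem exists_void_of_finite (ν : Measure (State d)) [IsFiniteMeasure ν] :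
    ∃ P : Measure (Config d), IsProbabilityMeasure P ∧ ∀ C, MeasurableSet C →
      P (void C) = ENNReal.ofReal (Real.exp (-ν.real C)) := by
  set P : Measure (Config d) := Measure.sum fun N : ℕ =>
    ENNReal.ofReal (Real.exp (-ν.real univ) / N.factorial) •
      (Measure.pi fun _ : Fin N => ν).map ofFin with hP
  have hvoid : ∀ C, MeasurableSet C → P (void C) = ENNReal.ofReal (Real.exp (-ν.real C)) := by
    intro C hC
    have hterm : ∀ N : ℕ, (ENNReal.ofReal (Real.exp (-ν.real univ) / N.factorial) •
        (Measure.pi fun _ : Fin N => ν).map ofFin) (void C) =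
        ENNReal.ofReal (Real.exp (-ν.real univ) * (ν.real Cᶜ ^ N / N.factorial)) := fun N => by
      have hpre : (ofFin : (Fin N → State d) → Config d) ⁻¹' void C = univ.pi fun _ => Cᶜ := by
        ext x; exact ofFin_mem_void
      rw [Measure.smul_apply, Measure.map_apply (measurable_ofFin N) (measurableSet_void hC), hpre,
        Measure.pi_pi, Finset.prod_const, Finset.card_univ, Fintype.card_fin, smul_eq_mul,
        ← ofReal_measureReal, ← ENNReal.ofReal_pow measureReal_nonneg,
        ← ENNReal.ofReal_mul (by positivity)]
      congr 1
      ring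
    have hs := (NormedSpace.expSeries_div_hasSum_exp (ν.real Cᶜ)).mul_left
      (Real.exp (-ν.real univ))
    rw [hP, Measure.sum_apply _ (measurableSet_void hC)]
    simp only [hterm]
    rw [← ENNReal.ofReal_tsum_of_nonneg (fun N => by positivity) hs.summable, hs.tsum_eq,
      ← Real.exp_eq_exp_ℝ, ← Real.exp_add]
    congr 2
    rw [measureReal_compl hC]
    ring
  refine ⟨P, ⟨?_⟩, hvoid⟩
  rw [← void_empty, hvoid ∅ .empty]
  simp

/-- Independent finite processes are placed on disjoint shells. A local set meets only finitely many
shells, so its void probability is a finite product. -/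
theorem exists_hasVoidProb (ν : Measure (State d)) (hν : ∀ C, IsLocal C → ν C ≠ ∞) :
    ∃ P : Measure (Config d), HasVoidProb ν P := by
  have hfin : ∀ n, IsFiniteMeasure (ν.restrict (shell n)) := fun n =>
    ⟨by simpa using (hν _ (isLocal_shell n)).lt_top⟩
  choose P hP hPv using fun n => exists_void_of_finite (ν.restrict (shell n))
  refine ⟨(Measure.infinitePi P).map merge,
    Measure.isProbabilityMeasure_map measurable_merge.aemeasurable, fun C hC => ⟨hν C hC, ?_⟩⟩
  obtain ⟨hCm, m, hm⟩ := id hC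
  have hempty : ∀ n, m ≤ n → C ∩ shell n = ∅ := fun n hn => by
    refine eq_empty_of_forall_notMem fun X hX => ?_
    have h1 := mem_ball_zero_iff.1 (hm hX.1).1
    have h2 : (n : ℝ) ≤ ‖X.1‖ := by
      rw [← (hX.2 : ⌊‖X.1‖⌋₊ = n)]
      exact Nat.floor_le (norm_nonneg _)
    exact absurd (Nat.cast_le.2 hn : (m : ℝ) ≤ n) (not_le.2 (h2.trans_lt h1))
  have hpre : (merge : (ℕ → Config d) → Config d) ⁻¹' void C =
      (Finset.range m : Set ℕ).pi fun n => void (C ∩ shell n) := by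
    ext ω
    simp only [mem_preimage, merge_mem_void, Set.mem_pi]
    refine ⟨fun h n _ => h n, fun h n => ?_⟩
    rcases lt_or_ge n m with hn | hn
    · exact h n (by simpa using hn)
    · rw [hempty n hn, void_empty]; trivial
  have hunion : C = ⋃ n ∈ Finset.range m, C ∩ shell n := by
    ext X
    simp only [mem_iUnion, Finset.mem_range]
    refine ⟨fun hX => ⟨⌊‖X.1‖⌋₊, ?_, hX, rfl⟩, fun ⟨_, _, h⟩ => h.1⟩
    by_contra hn
    exact (hempty _ (not_lt.1 hn)).subset ⟨hX, rfl⟩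
  have hsum : ν.real C = ∑ n ∈ Finset.range m, ν.real (C ∩ shell n) := by
    conv_lhs => rw [hunion]
    refine measureReal_biUnion_finset (fun a _ b _ hab =>
      (disjoint_shell hab).mono inter_subset_right inter_subset_right)
      (fun n _ => hCm.inter (measurableSet_shell n))
      (fun n _ => measure_ne_top_of_subset inter_subset_left (hν C hC))
  rw [Measure.map_apply measurable_merge (measurableSet_void hCm), hpre,
    Measure.infinitePi_pi _ fun n _ => measurableSet_void (hCm.inter (measurableSet_shell n)),
    ← measureReal_def, hsum, ← Finset.sum_neg_distrib, Real.exp_sum,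
    ENNReal.ofReal_prod_of_nonneg fun _ _ => Real.exp_nonneg _]
  refine Finset.prod_congr rfl fun n _ => ?_
  rw [hPv n _ (hCm.inter (measurableSet_shell n)), measureReal_restrict_apply
    (hCm.inter (measurableSet_shell n)), inter_assoc, inter_self]

/-- The intensity measure `z 𝓛^d ⊗ Q`. -/
abbrev intensity (d : ℕ) (z : ℝ≥0) (Q : Measure ℝ≥0) : Measure (State d) :=
  z • (volume : Measure (EuclideanSpace ℝ (Fin d))).prod Q

theorem intensity_ne_top (z : ℝ≥0) (Q : Measure ℝ≥0) [IsFiniteMeasure Q] (C : Set (State d))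
    (hC : IsLocal C) : intensity d z Q C ≠ ∞ := by
  obtain ⟨-, m, hm⟩ := hC
  refine measure_ne_top_of_subset hm ?_
  rw [Measure.smul_apply, Measure.prod_prod]
  exact ENNReal.mul_ne_top ENNReal.coe_ne_top
    (ENNReal.mul_ne_top measure_ball_lt_top.ne (measure_ne_top Q _))

theorem intensity_singleton (hd : 1 ≤ d) (z : ℝ≥0) (Q : Measure ℝ≥0) [IsFiniteMeasure Q]
    (x : State d) : intensity d z Q {x} = 0 := by
  have : Nonempty (Fin d) := ⟨⟨0, hd⟩⟩
  rw [Measure.smul_apply, ← singleton_prod_singleton, Measure.prod_prod, measure_singleton,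
    zero_mul, smul_zero]

theorem hasVoidProb_poissonLaw (hd : 1 ≤ d) (z : ℝ≥0) (Q : Measure ℝ≥0) [IsFiniteMeasure Q] :
    HasVoidProb (intensity d z Q) (poissonLaw z Q) := by
  have hex : ∃ P : Measure (Config d), IsPoissonProcess (intensity d z Q) P := by
    obtain ⟨P, hP⟩ := exists_hasVoidProb (intensity d z Q) (intensity_ne_top z Q)
    exact ⟨P, hP.isPoissonProcess (intensity_singleton hd z Q)⟩
  rw [poissonLaw, dif_pos hex]
  exact hex.choose_spec.hasVoidProb (intensity_ne_top z Q)

/-! ### Restriction, union, translation and gluing -/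

namespace Config

theorem restrict_mem_void {Λ : Set (EuclideanSpace ℝ (Fin d))} {ω : Config d}
    {C : Set (State d)} : ω.restrict Λ ∈ void C ↔ ω ∈ void (C ∩ Λ ×ˢ univ) := by
  rw [mem_void, mem_void, restrict, inter_assoc, inter_comm C]

theorem union_mem_void {ω ω' : Config d} {C : Set (State d)} :
    ω ∪ ω' ∈ void C ↔ ω ∈ void C ∧ ω' ∈ void C := by
  rw [mem_void, mem_void, mem_void, ← union_empty_iff, ← union_inter_distrib_right]
  rfl

/-- The translation of marked points by `x`. -/
def shift (x : EuclideanSpace ℝ (Fin d)) (X : State d) : State d := (X.1 + x, X.2)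

theorem measurable_shift (x : EuclideanSpace ℝ (Fin d)) : Measurable (shift x) :=
  (measurable_fst.add_const x).prodMk measurable_snd

theorem translate_mem_void {x : EuclideanSpace ℝ (Fin d)} {ω : Config d} {C : Set (State d)} :
    ω.translate x ∈ void C ↔ ω ∈ void (shift x ⁻¹' C) := by
  rw [mem_void', mem_void']
  exact forall_mem_image

theorem measurable_restrict {Λ : Set (EuclideanSpace ℝ (Fin d))} (hΛ : MeasurableSet Λ) :
    Measurable (restrict Λ) := by
  refine measurable_of_void fun C hC => ?_
  have : restrict Λ ⁻¹' void C = void (C ∩ Λ ×ˢ univ) := by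
    ext ω; exact restrict_mem_void
  rw [this]
  exact measurableSet_void (hC.1.inter (hΛ.prod .univ))

theorem measurable_union : Measurable fun p : Config d × Config d => p.1 ∪ p.2 := by
  refine measurable_of_void fun C hC => ?_
  have : (fun p : Config d × Config d => p.1 ∪ p.2) ⁻¹' void C = void C ×ˢ void C := by
    ext p; exact union_mem_void
  rw [this]
  exact (measurableSet_void hC.1).prod (measurableSet_void hC.1)

theorem measurable_translate (x : EuclideanSpace ℝ (Fin d)) : Measurable (translate x) := by
  refine measurable_of_void fun C hC => ?_
  have : translate x ⁻¹' void C = void (shift x ⁻¹' C) := by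
    ext ω; exact translate_mem_void
  rw [this]
  exact measurableSet_void (measurable_shift x hC.1)

end Config

/-- The event that for every colour `j` there is no point of colour `j` in `C j`. -/
def voidBox (C : Fin q → Set (State d)) : Set (MultiConfig d q) := univ.pi fun j => void (C j)

theorem mem_voidBox {C : Fin q → Set (State d)} {ω : MultiConfig d q} :
    ω ∈ voidBox C ↔ ∀ j, ω j ∈ void (C j) := by simp [voidBox]

theorem measurableSet_voidBox {C : Fin q → Set (State d)} (hC : ∀ j, MeasurableSet (C j)) :
    MeasurableSet (voidBox C) := MeasurableSet.univ_pi fun j => measurableSet_void (hC j)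

theorem ext_of_voidBox {P P' : Measure (MultiConfig d q)} [IsFiniteMeasure P]
    (h : ∀ C : Fin q → Set (State d), (∀ j, IsLocal (C j)) → P (voidBox C) = P' (voidBox C)) :
    P = P' := by
  refine ext_of_generate_finite _ (generateFrom_eq_pi (C := fun _ => localVoidEvents d)
    (fun _ => generateFrom_localVoidEvents) fun _ => ⟨fun _ => univ,
      fun _ => univ_mem_localVoidEvents, iUnion_const univ⟩).symm
    (IsPiSystem.pi fun _ => isPiSystem_localVoidEvents) ?_ ?_
  · rintro _ ⟨A, hA, rfl⟩
    choose C hC hCA using fun j => hA j (mem_univ j)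
    obtain rfl : A = fun j => void (C j) := funext hCA
    exact h C hC
  · have := h (fun _ => ∅) fun _ => ⟨.empty, 0, empty_subset _⟩
    simpa [voidBox, void_empty] using this

theorem measurable_multiRestrict {Λ : Set (EuclideanSpace ℝ (Fin d))} (hΛ : MeasurableSet Λ) :
    Measurable (multiRestrict Λ : MultiConfig d q → MultiConfig d q) :=
  measurable_pi_iff.2 fun j => (measurable_restrict hΛ).comp (measurable_pi_apply j)

theorem multiRestrict_mem_voidBox {Λ : Set (EuclideanSpace ℝ (Fin d))} {ω : MultiConfig d q}
    {C : Fin q → Set (State d)} :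
    multiRestrict Λ ω ∈ voidBox C ↔ ω ∈ voidBox fun j => C j ∩ Λ ×ˢ univ := by
  simp only [mem_voidBox, multiRestrict, restrict_mem_void]

theorem measurable_glue {Λ : Set (EuclideanSpace ℝ (Fin d))} (hΛ : MeasurableSet Λ) :
    Measurable fun p : MultiConfig d q × MultiConfig d q => glue Λ p.2 p.1 :=
  measurable_pi_iff.2 fun j => measurable_union.comp
    (((measurable_restrict hΛ).comp ((measurable_pi_apply j).comp measurable_snd)).prodMk
      ((measurable_restrict hΛ.compl).comp ((measurable_pi_apply j).comp measurable_fst)))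

theorem glue_mem_voidBox {Λ : Set (EuclideanSpace ℝ (Fin d))} {ω' ω : MultiConfig d q}
    {C : Fin q → Set (State d)} :
    glue Λ ω' ω ∈ voidBox C ↔ (ω' ∈ voidBox fun j => C j ∩ Λ ×ˢ univ) ∧
      ω ∈ voidBox fun j => C j ∩ Λᶜ ×ˢ univ := by
  simp only [mem_voidBox, glue, union_mem_void, restrict_mem_void, forall_and]

theorem glue_multiRestrict (Λ : Set (EuclideanSpace ℝ (Fin d))) (ω' ω : MultiConfig d q) :
    glue Λ (multiRestrict Λ ω') ω = glue Λ ω' ω := by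
  funext j
  have : ((ω' j).restrict Λ).restrict Λ = (ω' j).restrict Λ := by
    ext1
    simp only [Config.restrict, inter_assoc, inter_self]
  simp only [glue, multiRestrict, this]

/-! ### Invariance of the Poisson law under resampling and translation -/

theorem isProbabilityMeasure_poissonLaw (hd : 1 ≤ d) (y : ℝ≥0) (R : Measure ℝ≥0)
    [IsProbabilityMeasure R] : IsProbabilityMeasure (poissonLaw (d := d) y R) :=
  (hasVoidProb_poissonLaw hd y R).isProbabilityMeasure

theorem isProbabilityMeasure_multiPoisson (hd : 1 ≤ d) (z : Fin q → ℝ≥0) (Q : Fin q → Measure ℝ≥0)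
    [∀ j, IsProbabilityMeasure (Q j)] :
    IsProbabilityMeasure (multiPoisson (d := d) z Q) := by
  have := fun j => isProbabilityMeasure_poissonLaw hd (z j) (Q j)
  unfold multiPoisson
  infer_instance

theorem multiPoisson_pi (hd : 1 ≤ d) (z : Fin q → ℝ≥0) (Q : Fin q → Measure ℝ≥0)
    [∀ j, IsProbabilityMeasure (Q j)] (A : Fin q → Set (Config d)) :
    multiPoisson z Q (univ.pi A) = ∏ j, poissonLaw (z j) (Q j) (A j) := by
  have := fun j => isProbabilityMeasure_poissonLaw hd (z j) (Q j)
  exact Measure.pi_pi _ _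

/-- Independence of the process inside and outside `Λ`, read on void events: the exponent `ν C`
splits additively. -/
theorem poissonLaw_void_inter_mul (hd : 1 ≤ d) (y : ℝ≥0) (R : Measure ℝ≥0) [IsProbabilityMeasure R]
    {Λ : Set (EuclideanSpace ℝ (Fin d))} (hΛ : MeasurableSet Λ) {C : Set (State d)}
    (hC : IsLocal C) :
    poissonLaw y R (void (C ∩ Λ ×ˢ univ)) * poissonLaw y R (void (C ∩ Λᶜ ×ˢ univ)) =
      poissonLaw y R (void C) := by
  have h := hasVoidProb_poissonLaw hd y R
  have hν := intensity_ne_top y R C hC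
  rw [h.measure_void (hC.1.inter (hΛ.prod .univ)) (measure_ne_top_of_subset inter_subset_left hν),
    h.measure_void (hC.1.inter (hΛ.compl.prod .univ))
      (measure_ne_top_of_subset inter_subset_left hν),
    h.measure_void hC.1 hν, ← ENNReal.ofReal_mul (Real.exp_nonneg _), ← Real.exp_add, ← neg_add,
    ← ENNReal.toReal_add (measure_ne_top_of_subset inter_subset_left hν)
      (measure_ne_top_of_subset inter_subset_left hν)]
  have : Λᶜ ×ˢ (univ : Set ℝ≥0) = (Λ ×ˢ univ)ᶜ := by ext; simp
  rw [this, ← sdiff_eq, measure_inter_add_sdiff _ (hΛ.prod .univ)]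

/-- The Poisson law is unchanged when the configuration is resampled in a domain. -/
theorem map_glue_multiPoisson (hd : 1 ≤ d) (z : Fin q → ℝ≥0) (Q : Fin q → Measure ℝ≥0)
    [∀ j, IsProbabilityMeasure (Q j)] {Λ : Set (EuclideanSpace ℝ (Fin d))} (hΛ : MeasurableSet Λ) :
    ((multiPoisson z Q).prod (multiPoisson z Q)).map
      (fun p : MultiConfig d q × MultiConfig d q => glue Λ p.2 p.1) = multiPoisson z Q := by
  have := isProbabilityMeasure_multiPoisson hd z Q
  refine ext_of_voidBox fun C hC => ?_
  have hpre : (fun p : MultiConfig d q × MultiConfig d q => glue Λ p.2 p.1) ⁻¹' voidBox C =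
      (voidBox fun j => C j ∩ Λᶜ ×ˢ univ) ×ˢ (voidBox fun j => C j ∩ Λ ×ˢ univ) := by
    ext p
    exact glue_mem_voidBox.trans and_comm
  rw [Measure.map_apply (measurable_glue hΛ) (measurableSet_voidBox fun j => (hC j).1), hpre,
    Measure.prod_prod, voidBox, voidBox, voidBox, multiPoisson_pi hd, multiPoisson_pi hd,
    multiPoisson_pi hd, mul_comm, ← Finset.prod_mul_distrib]
  exact Finset.prod_congr rfl fun j _ => poissonLaw_void_inter_mul hd (z j) (Q j) hΛ (hC j)

theorem poissonLaw_map_translate (hd : 1 ≤ d) (y : ℝ≥0) (R : Measure ℝ≥0) [IsProbabilityMeasure R]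
    (x : EuclideanSpace ℝ (Fin d)) :
    (poissonLaw y R).map (Config.translate x) = poissonLaw y R := by
  have h := hasVoidProb_poissonLaw hd y R
  have := h.isProbabilityMeasure
  have := Measure.isProbabilityMeasure_map (μ := poissonLaw y R)
    (measurable_translate x).aemeasurable
  refine ext_of_void fun C hC => ?_
  have hpre : Config.translate x ⁻¹' void C = void (shift x ⁻¹' C) := by
    ext ω; exact translate_mem_void
  have hν : intensity d y R (shift x ⁻¹' C) = intensity d y R C := by
    have := ((measurePreserving_add_right (volume : Measure (EuclideanSpace ℝ (Fin d))) x).prod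
      (MeasurePreserving.id R)).measure_preimage hC.1.nullMeasurableSet
    rw [intensity, Measure.smul_apply, Measure.smul_apply, ← this]
    rfl
  have hfin := intensity_ne_top y R C hC
  rw [Measure.map_apply (measurable_translate x) (measurableSet_void hC.1), hpre,
    h.measure_void (measurable_shift x hC.1) (hν ▸ hfin), h.measure_void hC.1 hfin, hν]

theorem isStationary_multiPoisson (hd : 1 ≤ d) (z : Fin q → ℝ≥0) (Q : Fin q → Measure ℝ≥0)
    [∀ j, IsProbabilityMeasure (Q j)] : IsStationary (multiPoisson (d := d) z Q) := by
  intro x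
  have := fun j => isProbabilityMeasure_poissonLaw hd (z j) (Q j)
  have h : ∀ j, (poissonLaw (z j) (Q j)).map (Config.translate x) = poissonLaw (z j) (Q j) :=
    fun j => poissonLaw_map_translate hd (z j) (Q j) x
  have : ∀ j, SigmaFinite ((poissonLaw (z j) (Q j)).map (Config.translate x)) := fun j => by
    rw [h j]; infer_instance
  rw [multiPoisson, Measure.pi_map_pi fun j => (measurable_translate x).aemeasurable]
  simp only [h]

/-! ### Almost sure covering by one grain -/

/-- The marked points with centre outside the ball of radius `R` whose grain covers that ball. -/
def coveringSet (d : ℕ) (R : ℝ≥0) : Set (State d) :=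
  {X | (R : ℝ) < ‖X.1‖ ∧ ‖X.1‖ + R ≤ (X.2 : ℝ)}

theorem measurableSet_coveringSet (R : ℝ≥0) : MeasurableSet (coveringSet d R) :=
  (measurableSet_lt measurable_const measurable_fst.norm).inter
    (measurableSet_le (measurable_fst.norm.add_const _) measurable_snd.coe_nnreal_real)

theorem lintegral_tsub_pow_eq_top {Q : Measure ℝ≥0} [IsProbabilityMeasure Q]
    (h : ∫⁻ r, (r : ℝ≥0∞) ^ d ∂Q = ∞) (R : ℝ≥0) :
    ∫⁻ r, ((r - R : ℝ≥0) : ℝ≥0∞) ^ d ∂Q = ∞ := by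
  have hle : ∀ r : ℝ≥0, (r : ℝ≥0∞) ^ d ≤
      2 ^ (d - 1) * (((r - R : ℝ≥0) : ℝ≥0∞) ^ d + (R : ℝ≥0∞) ^ d) := fun r => by
    have h1 : r ^ d ≤ 2 ^ (d - 1) * ((r - R) ^ d + R ^ d) :=
      (pow_le_pow_left₀ zero_le (le_tsub_add : r ≤ r - R + R) d).trans
        (add_pow_le zero_le zero_le d)
    exact_mod_cast h1
  by_contra hne
  refine absurd h (ne_top_of_le_ne_top ?_ (lintegral_mono hle))
  rw [lintegral_const_mul _ (by fun_prop), lintegral_add_right _ measurable_const]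
  refine ENNReal.mul_ne_top (by finiteness) (ENNReal.add_ne_top.2 ⟨hne, ?_⟩)
  rw [lintegral_const, measure_univ, mul_one]
  finiteness

/-- The section at radius `r` is the closed ball of radius `r - R` without that of radius `R`. Its
volume is of order `(r - R) ^ d` up to a bounded error, which is not integrable against `Q`. -/
theorem intensity_coveringSet {z : ℝ≥0} (hz : 0 < z) {Q : Measure ℝ≥0}
    [IsProbabilityMeasure Q] (h : ∫⁻ r, (r : ℝ≥0∞) ^ d ∂Q = ∞) (R : ℝ≥0) :
    intensity d z Q (coveringSet d R) = ∞ := by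
  set E := EuclideanSpace ℝ (Fin d)
  have h1 : ∫⁻ r, (volume : Measure E) (Metric.closedBall 0 ((r - R : ℝ≥0) : ℝ)) ∂Q = ∞ := by
    have hvol : ∀ r : ℝ≥0, (volume : Measure E) (Metric.closedBall 0 ((r - R : ℝ≥0) : ℝ)) =
        ((r - R : ℝ≥0) : ℝ≥0∞) ^ d * (volume : Measure E) (Metric.ball 0 1) := fun r => by
      rw [Measure.addHaar_closedBall _ _ (NNReal.coe_nonneg _), ← NNReal.coe_pow,
        ENNReal.ofReal_coe_nnreal, finrank_euclideanSpace_fin, ENNReal.coe_pow]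
    simp only [hvol]
    rw [lintegral_mul_const _ (by fun_prop), lintegral_tsub_pow_eq_top h]
    exact ENNReal.top_mul (Metric.measure_ball_pos _ _ one_pos).ne'
  have h2 : ∀ r : ℝ≥0, (volume : Measure E) (Metric.closedBall 0 ((r - R : ℝ≥0) : ℝ)) ≤
      (volume : Measure E) ((fun x => (x, r)) ⁻¹' coveringSet d R) +
        (volume : Measure E) (Metric.closedBall 0 R) := fun r => by
    refine (measure_mono fun x hx => ?_).trans (measure_union_le _ _)
    rw [mem_closedBall_zero_iff] at hx
    rcases le_or_gt ‖x‖ R with hxR | hxR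
    · exact Or.inr (mem_closedBall_zero_iff.2 hxR)
    · refine Or.inl ⟨hxR, ?_⟩
      -- Otherwise the truncated difference `r - R` is `0`, against `‖x‖ > R`.
      have hRr : R ≤ r := by
        by_contra hlt
        rw [tsub_eq_zero_of_le (not_le.1 hlt).le, NNReal.coe_zero] at hx
        exact absurd (hxR.trans_le hx) (not_lt.2 R.coe_nonneg)
      rw [NNReal.coe_sub hRr] at hx
      exact le_sub_iff_add_le.1 hx
  have h3 : ∫⁻ r, (volume : Measure E) ((fun x => (x, r)) ⁻¹' coveringSet d R) ∂Q = ∞ := by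
    by_contra hne
    refine absurd h1 (ne_top_of_le_ne_top ?_ (lintegral_mono h2))
    rw [lintegral_add_right _ measurable_const, lintegral_const, measure_univ, mul_one]
    exact ENNReal.add_ne_top.2 ⟨hne, measure_closedBall_lt_top.ne⟩
  rw [Measure.smul_apply, Measure.prod_apply_symm (measurableSet_coveringSet R), h3]
  exact ENNReal.mul_top (by simpa using hz.ne')

/-- Only the colour `i` is present, and its grains centred outside `Λ` cover `Λ`. -/
def IsCovered (i : Fin q) (Λ : Set (EuclideanSpace ℝ (Fin d))) (ω : MultiConfig d q) : Prop :=
  (∀ j, j ≠ i → (ω j).carrier = ∅) ∧ Λ ⊆ ((ω i).restrict Λᶜ).grains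

theorem ae_isCovered (hd : 1 ≤ d) (z : Fin q → ℝ≥0) (hz : ∀ j, 0 < z j) (Q : Fin q → Measure ℝ≥0)
    [∀ j, IsProbabilityMeasure (Q j)] (i : Fin q) (hi : ∫⁻ r, (r : ℝ≥0∞) ^ d ∂(Q i) = ∞)
    {Λ : Set (EuclideanSpace ℝ (Fin d))} (hΛ : Bornology.IsBounded Λ) :
    ∀ᵐ ω ∂(multiPoisson (Pi.single i (z i)) Q), IsCovered i Λ ω := by
  have hp := fun j => isProbabilityMeasure_poissonLaw hd ((Pi.single i (z i) : Fin q → ℝ≥0) j) (Q j)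
  have hev := fun j => measurePreserving_eval
    (fun j => poissonLaw (d := d) ((Pi.single i (z i) : Fin q → ℝ≥0) j) (Q j)) j
  have h1 : ∀ j, j ≠ i → ∀ᵐ ω ∂(multiPoisson (Pi.single i (z i)) Q),
      ω j ∈ void (univ : Set (State d)) := fun j hj => by
    refine (hev j).quasiMeasurePreserving.ae ?_
    have hν : intensity d ((Pi.single i (z i) : Fin q → ℝ≥0) j) (Q j) univ = 0 := by
      rw [Pi.single_eq_of_ne hj, intensity, zero_smul]; rfl
    refine (mem_ae_iff_prob_eq_one (measurableSet_void .univ)).2 ?_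
    rw [(hasVoidProb_poissonLaw hd _ (Q j)).measure_void .univ (by simp [hν]), hν]
    simp
  obtain ⟨R, hR⟩ := hΛ.subset_closedBall 0
  have h2 : ∀ᵐ ω ∂(multiPoisson (Pi.single i (z i)) Q),
      ω i ∉ void (coveringSet d R.toNNReal) := by
    refine (hev i).quasiMeasurePreserving.ae (p := (· ∉ void (coveringSet d R.toNNReal))) ?_
    refine measure_eq_zero_iff_ae_notMem.1 ?_
    refine (hasVoidProb_poissonLaw hd _ (Q i)).measure_void_of_eq_top
      (measurableSet_coveringSet _) ?_
    rw [Pi.single_eq_same]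
    exact intensity_coveringSet (hz i) hi _
  filter_upwards [(ae_all_iff.2 fun j => Filter.eventually_imp_distrib_left.2 (h1 j)), h2]
    with ω hω hω2
  refine ⟨fun j hj => by simpa [mem_void] using hω j hj, fun y hy => ?_⟩
  rw [mem_void'] at hω2
  push Not at hω2
  obtain ⟨X, hX, hXR, hXr⟩ := hω2
  have hnorm : ∀ y ∈ Λ, ‖y‖ ≤ R.toNNReal := fun y hy =>
    (mem_closedBall_zero_iff.1 (hR hy)).trans (Real.le_coe_toNNReal R)
  -- The covering grain must be centred outside `Λ`, so that it survives resampling in `Λ`.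
  have hXΛ : X.1 ∉ Λ := fun h => absurd (hnorm _ h) (not_le.2 hXR)
  refine mem_iUnion₂.2 ⟨X, ⟨hX, hXΛ, trivial⟩, ?_⟩
  rw [Metric.mem_closedBall, dist_eq_norm]
  exact ((norm_sub_le y X.1).trans (by linarith [hnorm y hy])).trans hXr

/-! ### The specification in a covered domain -/

/-- The event that only the colour `i` is present in `Λ`. -/
def onlyColour (i : Fin q) (Λ : Set (EuclideanSpace ℝ (Fin d))) : Set (MultiConfig d q) :=
  voidBox fun j => if j = i then ∅ else Λ ×ˢ univ

/-- A point of another colour centred in `Λ` lies in a boundary grain of colour `i`, so its ball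
meets that colour. Conversely, with a single colour present no two colours can conflict. -/
theorem glue_mem_authorized_iff {i : Fin q} {Λ : Set (EuclideanSpace ℝ (Fin d))}
    {ω : MultiConfig d q} (hω : IsCovered i Λ ω) (ω' : MultiConfig d q) :
    glue Λ ω' ω ∈ authorized d q ↔ ω' ∈ onlyColour i Λ := by
  rw [onlyColour, mem_voidBox]
  constructor
  · intro h j
    split_ifs with hj
    · rw [void_empty]; trivial
    · rw [mem_void']
      intro X hX hXΛ
      have hdisj : (glue Λ ω' ω i).grains ∩ (glue Λ ω' ω j).grains = ∅ := by
        rcases lt_or_gt_of_ne hj with hlt | hlt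
        · rw [inter_comm]; exact h j i hlt
        · exact h i j hlt
      have hgi : X.1 ∈ (glue Λ ω' ω i).grains := by
        obtain ⟨Y, hY, hXY⟩ := mem_iUnion₂.1 (hω.2 hXΛ.1)
        exact mem_iUnion₂.2 ⟨Y, Or.inr hY, hXY⟩
      have hgj : X.1 ∈ (glue Λ ω' ω j).grains :=
        mem_iUnion₂.2 ⟨X, Or.inl ⟨hX, hXΛ⟩, Metric.mem_closedBall_self X.2.coe_nonneg⟩
      exact hdisj.subset ⟨hgi, hgj⟩
  · intro h
    have hempty : ∀ j, j ≠ i → (glue Λ ω' ω j).grains = ∅ := fun j hj => by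
      have h1 := h j
      rw [if_neg hj] at h1
      refine eq_empty_of_forall_notMem fun y hy => ?_
      obtain ⟨X, hX, -⟩ := mem_iUnion₂.1 hy
      rcases hX with hX | hX
      · exact mem_void'.1 h1 X hX.1 hX.2
      · exact (hω.1 j hj).subset hX.1
    intro j k hjk
    by_cases hj : j = i
    · rw [hempty k (hj ▸ hjk.ne'), inter_empty]
    · rw [hempty j hj, empty_inter]

theorem measurableSet_onlyColour (i : Fin q) {Λ : Set (EuclideanSpace ℝ (Fin d))}
    (hΛ : MeasurableSet Λ) : MeasurableSet (onlyColour i Λ) :=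
  measurableSet_voidBox fun j => by
    split_ifs
    exacts [.empty, hΛ.prod .univ]

/-- The multi-colour Poisson law on `Λ` restricted to the event that only the colour `i` is present
is a multiple of the one-colour Poisson law on `Λ`. -/
theorem exists_restrict_onlyColour (hd : 1 ≤ d) (z : Fin q → ℝ≥0) (Q : Fin q → Measure ℝ≥0)
    [∀ j, IsProbabilityMeasure (Q j)] (i : Fin q) {Λ : Set (EuclideanSpace ℝ (Fin d))}
    (hΛ : MeasurableSet Λ) (hb : Bornology.IsBounded Λ) :
    ∃ c : ℝ≥0∞, c ≠ 0 ∧ c ≠ ∞ ∧ (multiPoissonOn z Q Λ).restrict (onlyColour i Λ) =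
      c • multiPoissonOn (Pi.single i (z i)) Q Λ := by
  have hp := fun j => isProbabilityMeasure_poissonLaw hd (z j) (Q j)
  have hlocal : IsLocal (Λ ×ˢ univ : Set (State d)) := by
    simpa using isLocal_inter_prod (C := univ) .univ hΛ hb
  have hvoid : ∀ j, poissonLaw (z j) (Q j) (void (Λ ×ˢ univ : Set (State d))) ≠ 0 := fun j => by
    rw [((hasVoidProb_poissonLaw hd (z j) (Q j)).void_local _ hlocal).2]
    simpa using Real.exp_pos _
  -- The constant is the probability that no colour other than `i` has a point in `Λ`, positive
  -- because `Λ` is bounded.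
  refine ⟨∏ j, if j = i then 1 else poissonLaw (z j) (Q j) (void (Λ ×ˢ univ : Set (State d))),
    Finset.prod_ne_zero_iff.2 fun j _ => ?_, ENNReal.prod_ne_top fun j _ => ?_, ?_⟩
  · split_ifs
    exacts [one_ne_zero, hvoid j]
  · split_ifs
    exacts [ENNReal.one_ne_top, measure_ne_top _ _]
  have := isProbabilityMeasure_multiPoisson hd z Q
  have : IsProbabilityMeasure (multiPoissonOn (d := d) z Q Λ) :=
    Measure.isProbabilityMeasure_map (measurable_multiRestrict hΛ).aemeasurable
  refine ext_of_voidBox fun C hC => ?_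
  have hCm := measurableSet_voidBox fun j => (hC j).1
  have hpre : multiRestrict Λ ⁻¹' (voidBox C ∩ onlyColour i Λ) = univ.pi fun j =>
      if j = i then void (C j ∩ Λ ×ˢ univ) else void (Λ ×ˢ univ) := by
    ext ω
    rw [mem_preimage, mem_inter_iff, onlyColour, multiRestrict_mem_voidBox,
      multiRestrict_mem_voidBox, mem_voidBox, mem_voidBox, mem_univ_pi, ← forall_and]
    refine forall_congr' fun j => ?_
    split_ifs with hj
    · simp [void_empty]
    · rw [inter_self]
      exact and_iff_right_of_imp fun h => void_anti inter_subset_right h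
  have hpre' : multiRestrict Λ ⁻¹' voidBox C = univ.pi fun j => void (C j ∩ Λ ×ˢ univ) := by
    ext ω
    exact multiRestrict_mem_voidBox
  rw [Measure.restrict_apply hCm, Measure.smul_apply, multiPoissonOn, multiPoissonOn,
    Measure.map_apply (measurable_multiRestrict hΛ) (hCm.inter (measurableSet_onlyColour i hΛ)),
    Measure.map_apply (measurable_multiRestrict hΛ) hCm, hpre, hpre', multiPoisson_pi hd,
    multiPoisson_pi hd, smul_eq_mul, ← Finset.prod_mul_distrib]
  refine Finset.prod_congr rfl fun j _ => ?_
  split_ifs with hj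
  · subst hj
    rw [Pi.single_eq_same, one_mul]
  -- Under the single-colour activity, colour `j` has zero intensity, so its factor on the right is
  -- `1`.
  · have h0 : intensity d ((Pi.single i (z i) : Fin q → ℝ≥0) j) (Q j) (C j ∩ Λ ×ˢ univ) = 0 := by
      rw [Pi.single_eq_of_ne hj, intensity, zero_smul]; rfl
    rw [(hasVoidProb_poissonLaw hd ((Pi.single i (z i) : Fin q → ℝ≥0) j) (Q j)).measure_void
      ((hC j).1.inter (hΛ.prod .univ)) (by simp [h0]), h0]
    simp

/-- The restricted measure is a nonzero finite `c` times a probability measure; hence the partition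
function is `c`, and normalising cancels it. -/
theorem partitionFunction_pos_and_specification_eq (hd : 1 ≤ d) (z : Fin q → ℝ≥0)
    (Q : Fin q → Measure ℝ≥0) [∀ j, IsProbabilityMeasure (Q j)] {i : Fin q}
    {Λ : Set (EuclideanSpace ℝ (Fin d))} (hΛ : MeasurableSet Λ) (hb : Bornology.IsBounded Λ)
    {ω : MultiConfig d q} (hω : IsCovered i Λ ω) :
    0 < partitionFunction z Q Λ ω ∧
      specification z Q Λ ω = multiPoissonOn (Pi.single i (z i)) Q Λ := by
  obtain ⟨c, hc0, hct, hc⟩ := exists_restrict_onlyColour hd z Q i hΛ hb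
  have := isProbabilityMeasure_multiPoisson (d := d) hd (Pi.single i (z i)) Q
  have : IsProbabilityMeasure (multiPoissonOn (d := d) (Pi.single i (z i)) Q Λ) :=
    Measure.isProbabilityMeasure_map (measurable_multiRestrict hΛ).aemeasurable
  have hset : {ω' | glue Λ ω' ω ∈ authorized d q} = onlyColour i Λ :=
    ext fun ω' => glue_mem_authorized_iff hω ω'
  have hZ : partitionFunction z Q Λ ω = c := by
    rw [partitionFunction, hset, ← Measure.restrict_apply_univ, hc, Measure.smul_apply,
      measure_univ, smul_eq_mul, mul_one]
  refine ⟨hZ ▸ pos_iff_ne_zero.2 hc0, ?_⟩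
  rw [specification, hZ, hset, hc, smul_smul, ENNReal.inv_mul_cancel hc0 hct, one_smul]

/-- For a law under which `Λ` is almost surely covered by the colour `i`, applying the
Widom-Rowlinson specification amounts to resampling the one-colour Poisson process in `Λ`. -/
theorem integral_specification_eq (hd : 1 ≤ d) (z : Fin q → ℝ≥0) (Q : Fin q → Measure ℝ≥0)
    [∀ j, IsProbabilityMeasure (Q j)] {i : Fin q} {Λ : Set (EuclideanSpace ℝ (Fin d))}
    (hΛ : MeasurableSet Λ) (hb : Bornology.IsBounded Λ) {P : Measure (MultiConfig d q)}
    [IsProbabilityMeasure P] (hP : ∀ᵐ ω ∂P, IsCovered i Λ ω) {f : MultiConfig d q → ℝ}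
    (hf : Measurable f) (hfb : ∃ C : ℝ, ∀ ω, |f ω| ≤ C) :
    ∫ ω, ∫ ω', f (glue Λ ω' ω) ∂(specification z Q Λ ω) ∂P =
      ∫ ω, f ω ∂((P.prod (multiPoisson (Pi.single i (z i)) Q)).map
        fun p : MultiConfig d q × MultiConfig d q => glue Λ p.2 p.1) := by
  obtain ⟨C, hC⟩ := hfb
  have := isProbabilityMeasure_multiPoisson (d := d) hd (Pi.single i (z i)) Q
  have hfg : Measurable fun p : MultiConfig d q × MultiConfig d q => f (glue Λ p.2 p.1) :=
    hf.comp (measurable_glue hΛ)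
  rw [integral_map (measurable_glue hΛ).aemeasurable hf.aestronglyMeasurable,
    integral_prod _ (Integrable.of_bound hfg.aestronglyMeasurable C (ae_of_all _ fun p => hC _))]
  refine integral_congr_ae ?_
  filter_upwards [hP] with ω hω
  rw [(partitionFunction_pos_and_specification_eq hd z Q hΛ hb hω).2, multiPoissonOn,
    integral_map (measurable_multiRestrict hΛ).aemeasurable
      (show Measurable fun ω' => f (glue Λ ω' ω) from
        hfg.comp measurable_prodMk_left).aestronglyMeasurable]
  simp only [glue_multiRestrict]

/-! ### Membership and extremality -/

theorem multiPoisson_single_mem_WR (hd : 1 ≤ d) (z : Fin q → ℝ≥0) (hz : ∀ j, 0 < z j)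
    (Q : Fin q → Measure ℝ≥0) [∀ j, IsProbabilityMeasure (Q j)] (i : Fin q)
    (hi : ∫⁻ r, (r : ℝ≥0∞) ^ d ∂(Q i) = ∞) :
    multiPoisson (Pi.single i (z i)) Q ∈ WR d z Q := by
  have := isProbabilityMeasure_multiPoisson (d := d) hd (Pi.single i (z i)) Q
  refine ⟨this, isStationary_multiPoisson hd _ Q, fun Λ hΛ hb => ?_⟩
  have hcov := ae_isCovered hd z hz Q i hi hb
  refine ⟨hcov.mono fun ω hω => (partitionFunction_pos_and_specification_eq hd z Q hΛ hb hω).1,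
    fun f hf hfb => ?_⟩
  rw [integral_specification_eq hd z Q hΛ hb hcov hf hfb, map_glue_multiPoisson hd _ Q hΛ]

/-- Almost sure covering leaves only one candidate: the DLR equation in a ball replaces the content
of that ball by a Poisson sample, whatever `P` is, and void events inside balls determine the law.
-/
theorem eq_multiPoisson_single_of_mem_WR (hd : 1 ≤ d) (z : Fin q → ℝ≥0)
    (Q : Fin q → Measure ℝ≥0) [∀ j, IsProbabilityMeasure (Q j)] (i : Fin q)
    {P : Measure (MultiConfig d q)} (hP : P ∈ WR d z Q)
    (hcov : ∀ Λ, Bornology.IsBounded Λ → ∀ᵐ ω ∂P, IsCovered i Λ ω) :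
    P = multiPoisson (Pi.single i (z i)) Q := by
  have := hP.1
  have := isProbabilityMeasure_multiPoisson (d := d) hd (Pi.single i (z i)) Q
  refine ext_of_voidBox fun C hC => ?_
  choose m hm using fun j => (hC j).2
  set M := Finset.univ.sup m
  set Λ : Set (EuclideanSpace ℝ (Fin d)) := Metric.ball 0 M
  have hΛ : MeasurableSet Λ := Metric.isOpen_ball.measurableSet
  have hCΛ : ∀ j, C j ⊆ Λ ×ˢ univ := fun j => (hm j).trans
    (prod_mono_left (Metric.ball_subset_ball (Nat.cast_le.2 (Finset.le_sup (Finset.mem_univ j)))))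
  have hCm := measurableSet_voidBox fun j => (hC j).1
  have hmap : P = (P.prod (multiPoisson (Pi.single i (z i)) Q)).map
      fun p : MultiConfig d q × MultiConfig d q => glue Λ p.2 p.1 := by
    have := Measure.isProbabilityMeasure_map
      (μ := P.prod (multiPoisson (Pi.single i (z i)) Q)) (measurable_glue hΛ).aemeasurable
    ext A hA
    have hb : ∃ C : ℝ, ∀ ω, |A.indicator (1 : MultiConfig d q → ℝ) ω| ≤ C :=
      ⟨1, fun ω => by by_cases h : ω ∈ A <;> simp [h]⟩
    have hmeas : Measurable (A.indicator (1 : MultiConfig d q → ℝ)) :=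
      measurable_one.indicator hA
    have h := (hP.2.2 Λ hΛ Metric.isBounded_ball).2 _ hmeas hb
    rw [integral_specification_eq hd z Q hΛ Metric.isBounded_ball
      (hcov Λ Metric.isBounded_ball) hmeas hb, integral_indicator_one hA,
      integral_indicator_one hA] at h
    exact (measureReal_eq_measureReal_iff).1 h
  -- All the sets `C j` lie over `Λ`, so the event depends only on the resampled configuration.
  have hpre : (fun p : MultiConfig d q × MultiConfig d q => glue Λ p.2 p.1) ⁻¹' voidBox C =
      univ ×ˢ voidBox C := by
    ext p
    have h1 : ∀ j, C j ∩ Λ ×ˢ univ = C j := fun j => inter_eq_left.2 (hCΛ j)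
    have h2 : ∀ j, C j ∩ Λᶜ ×ˢ univ = ∅ := fun j => by
      refine eq_empty_of_forall_notMem fun X hX => hX.2.1 (hCΛ j hX.1).1
    rw [mem_preimage, glue_mem_voidBox]
    simp only [h1, h2, mem_prod, mem_univ, true_and, and_iff_left_iff_imp]
    exact fun _ => mem_voidBox.2 fun j => by rw [void_empty]; trivial
  rw [hmap, Measure.map_apply (measurable_glue hΛ) hCm, hpre, Measure.prod_prod, measure_univ,
    one_mul]

end WidomRowlinson

end

/-- If `∫ r^d Q_i(dr) = ∞`, the Poisson point process with activity vector `(0, …, z_i, …, 0)` is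
an extreme point of the set of Widom-Rowlinson measures `WR(z, Q)`. -/
theorem mainTheorem6 (d q : ℕ) (hd : 1 ≤ d) (z : Fin q → ℝ≥0) (hz : ∀ j, 0 < z j)
    (Q : Fin q → Measure ℝ≥0) (hQ : ∀ j, IsProbabilityMeasure (Q j))
    (i : Fin q) (hi : ∫⁻ r, (r : ℝ≥0∞) ^ d ∂(Q i) = ∞) :
    WidomRowlinson.multiPoisson (Pi.single i (z i)) Q ∈
      Set.extremePoints ℝ≥0 (WidomRowlinson.WR d z Q) := by
  refine ⟨WidomRowlinson.multiPoisson_single_mem_WR hd z hz Q i hi, ?_⟩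
  -- Only `P₁` has to be identified: the roles of the two components are symmetric. Covering passes
  -- to `P₁` by absolute continuity, since `a ≠ 0`.
  rintro P₁ hP₁ P₂ - ⟨a, b, ha, -, -, hab⟩
  refine WidomRowlinson.eq_multiPoisson_single_of_mem_WR hd z Q i hP₁ fun Λ hΛ => ?_
  have hac : P₁ ≪ WidomRowlinson.multiPoisson (Pi.single i (z i)) Q := by
    refine Measure.AbsolutelyContinuous.mk fun s _ hs => ?_
    rw [← hab, Measure.add_apply, add_eq_zero, Measure.smul_apply] at hs
    exact (smul_eq_zero.1 hs.1).resolve_left ha.ne'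
  exact hac.ae_le (WidomRowlinson.ae_isCovered hd z hz Q i hi hΛ)
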